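/- A rooted planar map is a proper embedding of a finite connected graph (loops and multiple edges allowed) in the oriented sphere, considered up to orientation-preserving homeomorphism, together with a choice of an oriented edge (the root-edge). Non-atomic rooted maps are encoded in the standard combinatorial way: a finite set of darts (oriented edges) with a permutation $\sigma$ (counterclockwise rotation around the origin), a fixed-point-free involution $\alpha$ (reversal of an edge), $\langle\sigma,\alpha\rangle$ being transitive, and a root dart, up to root-preserving isomorphism; vertices, edges and faces are the cycles of $\sigma$, $\alpha$ and $\sigma\alpha$, and planarity means $\#\text{vertices}-\#\text{edges}+\#\text{faces}=2$. A map is 4-valent if every vertex has degree $4$ (loops count twice). By convention there is exactly one 4-valent rooted planar map with $0$ vertices (an oriented circle without vertex). A blossoming tree is a plane binary tree, rooted at a leaf, in which every inner node carries, in addition to its two children, a flower, placed in one of three possible positions (before, between, or after the two children); the tree reduced to a single edge is the one with no inner node. **Theorem.** 1. For every $n\ge 0$, the number of 4-valent rooted planar maps with $n$ vertices is $$\frac{2\cdot 3^n}{(n+1)(n+2)}\binom{2n}{n}.$$ 2. Let $M(t)$ be the generating function of 4-valent rooted planar maps, counted by vertices, and $T(t)$ the generating function of blossoming trees, counted by inner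 nodes. Then, as formal power series in $\mathbb{Q}[[t]]$, $$T(t)=1+3t\,T(t)^2,\qquad M(t)=T(t)-t\,T(t)^3,$$ and $M(t)$ is algebraic over $\mathbb{Q}(t)$. -/

import Mathlib

/-- A (finite, connected, non-atomic) rooted map, encoded by its darts (half-edges, equivalently
oriented edges). A dart is an edge together with one of its two orientations; a map on the oriented
surface, up to orientation preserving homeomorphism, is the same thing as the permutation `σ`
("next dart counterclockwise around the same origin") together with the fixed-point-free involution
`α` ("same edge, opposite orientation"), up to relabelling of the darts. Loops and multiple edges
are allowed. The map is rooted by orienting one edge, that is, by choosing a dart. -/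
structure RootedMap where
  /-- The darts (oriented edges). -/
  Dart : Type
  /-- There are finitely many darts. -/
  finite_dart : Finite Dart
  /-- The next dart, counterclockwise, around the origin of a dart. -/
  σ : Equiv.Perm Dart
  /-- The same edge with the opposite orientation. -/
  α : Equiv.Perm Dart
  α_involutive : ∀ d, α (α d) = d
  α_ne : ∀ d, α d ≠ d
  /-- The underlying graph is connected. -/
  connected : ∀ d d' : Dart, ∃ g ∈ Subgroup.closure ({σ, α} : Set (Equiv.Perm Dart)), g d = d'
  /-- The root-edge, with its orientation. -/
  root : Dart

namespace RootedMap

/-- Turning around a face: from the dart `d` one goes to the dart that follows `d` when walking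
along the border of the face lying to the right of `d`. -/
def φ (M : RootedMap) : Equiv.Perm M.Dart := M.σ * M.α

/-- A vertex is a cycle of `σ` (the darts having this vertex as origin). -/
def Vertex (M : RootedMap) : Type := Quotient (Equiv.Perm.SameCycle.setoid M.σ)

/-- An edge is a cycle of `α` (its two orientations). -/
def Edge (M : RootedMap) : Type := Quotient (Equiv.Perm.SameCycle.setoid M.α)

/-- A face is a cycle of `φ` (the darts having this face on their right). -/
def Face (M : RootedMap) : Type := Quotient (Equiv.Perm.SameCycle.setoid M.φ)

/-- The origin of a dart. -/
def origin (M : RootedMap) (d : M.Dart) : M.Vertex :=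
  Quotient.mk (Equiv.Perm.SameCycle.setoid M.σ) d

/-- The degree of a vertex: the number of incident edges, counted with multiplicity (so a loop
counts twice). -/
noncomputable def degree (M : RootedMap) (v : M.Vertex) : ℕ :=
  Nat.card {d : M.Dart // M.origin d = v}

/-- The surface carrying the map is the sphere, i.e. its Euler characteristic
`#vertices - #edges + #faces` is `2`. -/
def IsPlanar (M : RootedMap) : Prop :=
  Nat.card M.Vertex + Nat.card M.Face = Nat.card M.Edge + 2

/-- A map is 4-valent if all its vertices have degree 4. -/
def IsFourValent (M : RootedMap) : Prop :=
  ∀ v : M.Vertex, M.degree v = 4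

/-- Two rooted maps are identified when a bijection between their darts respects the rotation
around the vertices, the reversal of the edges, and the root. -/
def Iso (M N : RootedMap) : Prop :=
  ∃ e : M.Dart ≃ N.Dart,
    (∀ d, e (M.σ d) = N.σ (e d)) ∧ (∀ d, e (M.α d) = N.α (e d)) ∧ e M.root = N.root

theorem Iso.refl (M : RootedMap) : M.Iso M :=
  ⟨Equiv.refl _, fun _ => rfl, fun _ => rfl, rfl⟩

theorem Iso.symm {M N : RootedMap} : M.Iso N → N.Iso M := by
  rintro ⟨e, h1, h2, h3⟩
  refine ⟨e.symm, fun d => ?_, fun d => ?_, ?_⟩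
  · rw [Equiv.symm_apply_eq, h1, Equiv.apply_symm_apply]
  · rw [Equiv.symm_apply_eq, h2, Equiv.apply_symm_apply]
  · rw [Equiv.symm_apply_eq, h3]

theorem Iso.trans {M N P : RootedMap} : M.Iso N → N.Iso P → M.Iso P := by
  rintro ⟨e, h1, h2, h3⟩ ⟨f, k1, k2, k3⟩
  refine ⟨e.trans f, fun d => ?_, fun d => ?_, ?_⟩
  · simp [h1, k1]
  · simp [h2, k2]
  · simp [h3, k3]

/-- Isomorphism of rooted maps, as an equivalence relation. -/
instance isoSetoid : Setoid RootedMap where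
  r := Iso
  iseqv := ⟨Iso.refl, Iso.symm, Iso.trans⟩

end RootedMap

/-- The 4-valent rooted planar maps with `n` vertices, up to isomorphism, for `n ≥ 1`
(this type is empty for `n = 0`, since a `RootedMap` has at least one dart). -/
def FourValentPlanarMap (n : ℕ) : Type 1 :=
  Quotient (RootedMap.isoSetoid.comap
    (Subtype.val : {M : RootedMap // M.IsPlanar ∧ M.IsFourValent ∧ Nat.card M.Vertex = n} →
      RootedMap))

/-- The number of 4-valent rooted planar maps with `n` vertices. By convention there is exactly one
such map with no vertex: a closed oriented edge (a circle) without vertex on the sphere. -/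
noncomputable def fourValentCount (n : ℕ) : ℕ :=
  if n = 0 then 1 else Nat.card (FourValentPlanarMap n)

/-- The generating function of 4-valent rooted planar maps, counted by vertices. -/
noncomputable def fourValentGF : PowerSeries ℚ :=
  PowerSeries.mk fun n => (fourValentCount n : ℚ)

/-- Blossoming trees: plane binary trees, rooted at a leaf, in which each inner node carries, in
addition to its left and right subtrees, a flower in one of three possible positions (before, between
or after the two subtrees). The constructors describe what hangs from the root leaf: `leaf` is the
tree reduced to one edge joining the root leaf to another leaf. -/
inductive BlossomingTree : Type
  | leaf : BlossomingTree
  | node (flower : Fin 3) (left right : BlossomingTree) : BlossomingTree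

/-- The number of inner nodes of a blossoming tree. -/
def BlossomingTree.innerNodes : BlossomingTree → ℕ
  | .leaf => 0
  | .node _ l r => l.innerNodes + r.innerNodes + 1

/-- The generating function of blossoming trees, counted by inner nodes. -/
noncomputable def blossomingTreeGF : PowerSeries ℚ :=
  PowerSeries.mk fun n => (Nat.card {t : BlossomingTree // t.innerNodes = n} : ℚ)

/-! The proof is Tutte's root-edge recursion, with maps replaced by words. Let a_p(t) count planar
maps with root vertex of degree p, all other vertices having degree 4. The root edge either leads to
a new vertex, and contracting it replaces root degree p+1 by p+3 and uses up one vertex, or it is a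
loop, which on the sphere separates the root vertex into two of degrees i and j. Hence a_0 = 1 and
a_{p+1} = Σ_{i+j=p-1} a_i a_j + t a_{p+3}. A closed form built from T and a Catalan series solves
this recursion with a_2 = T - t T³ (`exists_rootDegree_series`). Since a_2 = 1 + t a_4, the
coefficient of t^(n+1) in a_2 counts the exploration words starting from root degree 4 with n
further vertices (`exists_finset_hasShape`, `card_hasShape_four`).

It remains to match words with maps. Running the recursion on the darts of a map keeps a list of
pending root vertices and records one letter per step (`Explores`). A successful run determines its
word, a word determines the map up to isomorphism (`Explores.exists_map`), and every word of the
right shape is realized by a pairing of given darts (`HasShape.exists_involution`).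

Planarity is what makes the run succeed. Using an edge {r, d} replaces (s, A) by (s * swap r d, swap
r d * A), so the product, hence the number of faces, is unchanged. The quantity 2 * (cycles of s) +
(live darts on pending root vertices) is preserved by all steps of the recursion, and drops exactly
when an edge joins two different pending root vertices, that is, when there is a handle. It bounds
twice the number of faces, and for the initial state of a 4-valent map equality is Euler's formula
of the sphere (`IsState.cycleCount_le`, `IsState.cycleCount_eq`, `IsFourValent.isPlanar_iff`).

For blossoming trees, decomposing at the root gives the Catalan recursion with a factor 3 for each
inner node. -/

open PowerSeries in
/-- The power series `T = 1 + 3 t T²`, with explicit coefficients. -/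
noncomputable def ternaryCatalanGF : PowerSeries ℚ :=
  PowerSeries.mk fun n => 3 ^ n * (catalan n : ℚ)

/-! ### Power series: T, T - t T³, and a solution of the root-edge recursion -/

section Algebra
open PowerSeries

/-- This is the quadratic equation of the Catalan series with the variable rescaled by 3. -/
theorem ternaryCatalanGF_eq :
    ternaryCatalanGF = 1 + 3 * X * ternaryCatalanGF ^ 2 := by
  have h := congrArg (fun f => rescale (3 : ℚ) (PowerSeries.map (Nat.castRingHom ℚ) f))
    catalanSeries_sq_mul_X_add_one
  have e : rescale (3 : ℚ) (PowerSeries.map (Nat.castRingHom ℚ) catalanSeries)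
      = ternaryCatalanGF := by
    ext n; simp [ternaryCatalanGF, coeff_rescale]
  have hC : (C (3 : ℚ) : PowerSeries ℚ) = 3 := map_ofNat C 3
  simp only [map_add, map_mul, map_pow, map_one, map_X, e, rescale_X, hC] at h
  linear_combination -h

/-- The power series `T - t T³`. -/
noncomputable def tutteGF : PowerSeries ℚ :=
  ternaryCatalanGF - X * ternaryCatalanGF ^ 3

/-- Multiplying T = 1 + 3 t T² by T eliminates T³. Only T² remains, whose coefficients are again
Catalan numbers. -/
theorem three_mul_tutteGF :
    3 * tutteGF = 4 * ternaryCatalanGF - ternaryCatalanGF ^ 2 := by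
  rw [tutteGF]
  linear_combination ternaryCatalanGF * ternaryCatalanGF_eq

theorem coeff_ternaryCatalanGF_sq (n : ℕ) :
    coeff n (ternaryCatalanGF ^ 2) = 3 ^ n * (catalan (n + 1) : ℚ) := by
  have h := congrArg (coeff (n + 1)) ternaryCatalanGF_eq
  rw [map_add, show (3 : PowerSeries ℚ) * X * ternaryCatalanGF ^ 2
    = C (3 : ℚ) * (X * ternaryCatalanGF ^ 2) by rw [show (C (3 : ℚ) : PowerSeries ℚ) = 3 from map_ofNat C 3, mul_assoc], coeff_C_mul, coeff_succ_X_mul,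
    ternaryCatalanGF, coeff_mk, coeff_one, if_neg (Nat.succ_ne_zero n), zero_add, pow_succ] at h
  rw [ternaryCatalanGF]
  linarith

theorem coeff_tutteGF (n : ℕ) :
    coeff n tutteGF =
      2 * 3 ^ n * (Nat.choose (2 * n) n : ℚ) / (((n : ℚ) + 1) * ((n : ℚ) + 2)) := by
  have h := congrArg (coeff n) three_mul_tutteGF
  rw [map_sub, show (3 : PowerSeries ℚ) = C (3 : ℚ) from (map_ofNat C 3).symm,
    show (4 : PowerSeries ℚ) = C (4 : ℚ) from (map_ofNat C 4).symm, coeff_C_mul, coeff_C_mul,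
    coeff_ternaryCatalanGF_sq] at h
  rw [ternaryCatalanGF, coeff_mk] at h
  have h1 : ((n : ℚ) + 1) * catalan n = Nat.choose (2 * n) n := by
    have := succ_mul_catalan_eq_centralBinom n
    rw [Nat.centralBinom_eq_two_mul_choose] at this
    exact_mod_cast this
  have h2 : ((n : ℚ) + 2) * catalan (n + 1) = 2 * (2 * n + 1) * catalan n := by
    have a := succ_mul_catalan_eq_centralBinom (n + 1)
    have b := Nat.succ_mul_centralBinom_succ n
    rw [← a, ← succ_mul_catalan_eq_centralBinom n] at b
    have b' : ((n : ℚ) + 1) * ((n + 1 + 1) * catalan (n + 1)) =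
      2 * (2 * n + 1) * ((n + 1) * catalan n) := by exact_mod_cast b
    have : (n : ℚ) + 1 ≠ 0 := by positivity
    apply mul_left_cancel₀ this
    linear_combination b'
  have p1 : (n : ℚ) + 1 ≠ 0 := by positivity
  have p2 : (n : ℚ) + 2 ≠ 0 := by positivity
  rw [eq_div_iff (by positivity), ← h1]
  linear_combination ((n + 1) * (n + 2) / 3 : ℚ) * h - ((n + 1) * 3 ^ n / 3 : ℚ) * h2

theorem coeff_zero_tutteGF : coeff 0 tutteGF = 1 := by
  rw [coeff_tutteGF]; norm_num

theorem isAlgebraic_tutteGF : IsAlgebraic (Polynomial ℚ) tutteGF := by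
  have hT : IsAlgebraic (Polynomial ℚ) ternaryCatalanGF := by
    -- The quadratic equation of T, as a polynomial in T; its constant term 1 shows that it is
    -- nonzero.
    refine ⟨Polynomial.C (3 * Polynomial.X) * Polynomial.X ^ 2 - Polynomial.X + 1, ?_, ?_⟩
    · intro h
      have := congrArg (fun p => Polynomial.coeff p 0) h
      simp at this
    · have h := ternaryCatalanGF_eq
      simp only [map_add, map_sub, map_mul, map_pow, Polynomial.aeval_X, Polynomial.aeval_C, map_one,
        map_ofNat]
      have e : algebraMap (Polynomial ℚ) (PowerSeries ℚ) Polynomial.X = X := by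
        simp [PowerSeries.algebraMap_apply']
      rw [e]
      linear_combination -h
  have hX : IsAlgebraic (Polynomial ℚ) (X : PowerSeries ℚ) := by
    have : (X : PowerSeries ℚ) = algebraMap (Polynomial ℚ) (PowerSeries ℚ) Polynomial.X := by
      simp [PowerSeries.algebraMap_apply']
    rw [this]
    exact isAlgebraic_algebraMap _
  exact hT.sub (hX.mul (hT.pow 3))

/-- In a power series ring, the equation `C = 1 + X G C²` has a solution. -/
theorem exists_eq_one_add_X_mul_sq {R : Type*} [CommRing R] (G : PowerSeries R) :
    ∃ S : PowerSeries R, S = 1 + X * G * S ^ 2 := by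
  have hs : HasSubst (X * G) := HasSubst.of_constantCoeff_zero' (by simp)
  refine ⟨(PowerSeries.map (Nat.castRingHom R) catalanSeries).subst (X * G), ?_⟩
  have h := congrArg (fun f => (PowerSeries.map (Nat.castRingHom R) f).subst (X * G))
    catalanSeries_sq_mul_X_add_one
  simp only [map_add, map_mul, map_pow, map_one, map_X] at h
  rw [← coe_substAlgHom hs] at h ⊢
  simp only [map_add, map_mul, map_pow, map_one, substAlgHom_X] at h
  linear_combination -h

/-- Power series `a p`, for `p : ℕ`, satisfying the root-edge recursion of 4-valent planar maps
with a root vertex of arbitrary degree `p`. -/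
theorem exists_rootDegree_series : ∃ a : ℕ → PowerSeries ℚ, a 0 = 1 ∧ a 2 = tutteGF ∧
    ∀ p, a (p + 1) = (if p = 0 then 0 else
      ∑ ij ∈ Finset.HasAntidiagonal.antidiagonal (p - 1), a ij.1 * a ij.2) + X * a (p + 3) := by
  set T := ternaryCatalanGF with hTdef
  have hT : T = 1 + 3 * X * T ^ 2 := ternaryCatalanGF_eq
  -- In the two-variable ring the outer `X`, written x, marks the root degree, and `C X` is t,
  -- marking vertices. S is the Catalan series evaluated at T x².
  obtain ⟨S, hS⟩ := exists_eq_one_add_X_mul_sq (C T * X : PowerSeries (PowerSeries ℚ))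
  -- An explicit candidate for Σ a_p x^p. At x = 0 it equals T (1 - 3 t T) = 1.
  set W : PowerSeries (PowerSeries ℚ) :=
    C T * S * (1 - 2 * C (X * T) - C (X * T) * S) with hW
  have hT' : (C T : PowerSeries (PowerSeries ℚ)) = 1 + 3 * C X * (C T) ^ 2 := by
    conv_lhs => rw [hT]
    simp only [map_add, map_mul, map_pow, map_one, map_ofNat]
  -- The recursion multiplied by x^(p+3) and summed over p. It follows from the equations of T and S
  -- alone.
  have key : X ^ 2 * (W - 1) = X ^ 4 * W ^ 2 + C X * (W - 1 - X ^ 2 * C tutteGF) := by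
    rw [hW, tutteGF, ← hTdef]
    simp only [map_sub, map_mul, map_pow]
    generalize (C T : PowerSeries (PowerSeries ℚ)) = t at *
    generalize (C X : PowerSeries (PowerSeries ℚ)) = z at *
    grind
  have h0 : coeff 0 W = 1 := by
    have hS0 : coeff 0 S = 1 := by
      rw [hS, coeff_zero_eq_constantCoeff]; simp
    rw [coeff_zero_eq_constantCoeff] at hS0 ⊢
    rw [hW]
    have h2 : constantCoeff (2 : PowerSeries (PowerSeries ℚ)) = 2 := map_ofNat _ 2
    simp only [map_mul, map_sub, map_one, constantCoeff_C, hS0, h2]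
    linear_combination hT
  refine ⟨fun p => coeff p W, h0, ?_, fun p => ?_⟩
  -- The coefficient of x² reads t (a_2 - M) = 0 with M = T - t T³, so a_2 is identified by
  -- cancelling t.
  · have h := congrArg (coeff 2) key
    rw [map_add, coeff_C_mul, coeff_X_pow_mul', coeff_X_pow_mul', if_pos le_rfl,
      if_neg (by norm_num), map_sub, map_sub, map_sub, coeff_X_pow_mul', if_pos le_rfl,
      coeff_C, coeff_one, coeff_one] at h
    simp only [Nat.sub_self, h0, if_true, sub_self, zero_add, sub_zero, OfNat.ofNat_ne_zero,
      if_false] at h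
    have := (mul_eq_zero.mp h.symm).resolve_left X_ne_zero
    exact sub_eq_zero.mp this
  · have h := congrArg (coeff (p + 3)) key
    have hX : ∀ f : PowerSeries (PowerSeries ℚ), coeff (p + 3) (X ^ 2 * f) = coeff (p + 1) f :=
      fun f => coeff_X_pow_mul f 2 (p + 1)
    have h4 : coeff (p + 3) (X ^ 4 * W ^ 2) = if p = 0 then 0 else
        ∑ ij ∈ Finset.HasAntidiagonal.antidiagonal (p - 1), coeff ij.1 W * coeff ij.2 W := by
      rw [coeff_X_pow_mul']
      rcases Nat.eq_zero_or_pos p with rfl | hp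
      · simp
      · rw [if_pos (by omega), if_neg (by omega), show p + 3 - 4 = p - 1 by omega, pow_two,
          coeff_mul]
    rw [map_add, coeff_C_mul, h4, hX, map_sub, map_sub, map_sub, hX, coeff_C, coeff_one,
      coeff_one] at h
    simpa using h

end Algebra

open Equiv Equiv.Perm

/-! ### Cycles of a permutation multiplied by a transposition -/

section CycleCount
variable {D : Type*}

/-- The number of cycles (fixed points included) of a permutation. -/
noncomputable def cycleCount (s : Perm D) : ℕ := Nat.card (Quotient (SameCycle.setoid s))

theorem rel_of_sameCycle {s : Perm D} {R : Setoid D} (h : ∀ x, R x (s x)) {x y : D}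
    (hxy : SameCycle s x y) : R x y := by
  obtain ⟨i, rfl⟩ := hxy
  have key : ∀ (n : ℕ) (z : D), R z ((s ^ n) z) := by
    intro n
    induction n with
    | zero => intro z; exact R.refl z
    | succ n ih => intro z; rw [pow_succ']; exact R.trans (ih z) (h _)
  cases i with
  | ofNat n => exact key n x
  | negSucc n =>
    rw [zpow_negSucc]
    have := key (n + 1) ((s ^ (n + 1))⁻¹ x)
    rw [show (s ^ (n + 1)) ((s ^ (n + 1))⁻¹ x) = x by simp] at this
    exact R.symm this

theorem mem_of_sameCycle [Finite D] {s : Perm D} {Y : Set D} (h : ∀ x ∈ Y, s x ∈ Y) {x y : D}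
    (hx : x ∈ Y) (hxy : SameCycle s x y) : y ∈ Y := by
  obtain ⟨n, -, rfl⟩ := hxy.exists_pow_eq'
  clear hxy
  induction n with
  | zero => exact hx
  | succ n ih => rw [pow_succ']; exact h _ ih

variable [DecidableEq D]

theorem sameCycle_mul_swap [Finite D] {s : Perm D} {a b : D} (h : ¬ SameCycle s a b) :
    SameCycle (s * swap a b) a b := by
  by_contra hn
  have hab : a ≠ b := fun e => hn (e ▸ SameCycle.refl _ _)
  set s' := s * swap a b with hs'
  have ha : s' a = s b := by simp [hs']
  -- Follow s from s b = s' a. As long as the points lie in both the s-cycle of b and the s'-cycle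
  -- of a, neither a nor b is met, so s and s' agree there. Hence the whole s-cycle of b, including
  -- b itself, would lie in the s'-cycle of a.
  let Z : Set D := {x | SameCycle s' a x ∧ SameCycle s b x}
  have hZ : ∀ x ∈ Z, s x ∈ Z := by
    rintro x ⟨h1, h2⟩
    have hxa : x ≠ a := fun e => h (e ▸ h2.symm)
    have hxb : x ≠ b := fun e => hn (e ▸ h1)
    have : s' x = s x := by simp [hs', swap_apply_of_ne_of_ne hxa hxb]
    exact ⟨this ▸ sameCycle_apply_right.mpr h1, sameCycle_apply_right.mpr h2⟩
  have hb : s b ∈ Z := ⟨ha ▸ sameCycle_apply_right.mpr (SameCycle.refl _ _),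
    sameCycle_apply_right.mpr (SameCycle.refl _ _)⟩
  exact hn (mem_of_sameCycle hZ hb (sameCycle_apply_left.mpr (SameCycle.refl s b))).1

/-- The transposition merges the cycles of a and b and leaves the others alone, so the cycles of the
product correspond to the cycles of s other than that of b. -/
theorem cycleCount_mul_swap [Finite D] {s : Perm D} {a b : D} (h : ¬ SameCycle s a b) :
    cycleCount (s * swap a b) + 1 = cycleCount s := by
  have hab : SameCycle (s * swap a b) a b := sameCycle_mul_swap h
  set s' := s * swap a b with hs'
  have ha : s' a = s b := by simp [hs']
  have hb : s' b = s a := by simp [hs']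
  have hne : ∀ x, x ≠ a → x ≠ b → s' x = s x := fun x h1 h2 => by
    simp [hs', swap_apply_of_ne_of_ne h1 h2]
  have f1 : ∀ {x y}, SameCycle s x y → SameCycle s' x y := by
    intro x y hxy
    refine rel_of_sameCycle (R := SameCycle.setoid s') (fun x => ?_) hxy
    change SameCycle s' x (s x)
    by_cases hxa : x = a
    · subst hxa; rw [← hb]; exact sameCycle_apply_right.mpr hab
    by_cases hxb : x = b
    · subst hxb; rw [← ha]; exact sameCycle_apply_right.mpr hab.symm
    · rw [← hne x hxa hxb]; exact sameCycle_apply_right.mpr (SameCycle.refl _ _)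
  let R : Setoid D :=
    { r := fun x y => SameCycle s x y ∨
        ((SameCycle s a x ∨ SameCycle s b x) ∧ (SameCycle s a y ∨ SameCycle s b y))
      iseqv := by
        refine ⟨fun x => Or.inl (SameCycle.refl _ _), ?_, ?_⟩
        · rintro x y (h | ⟨h1, h2⟩)
          · exact Or.inl h.symm
          · exact Or.inr ⟨h2, h1⟩
        · rintro x y z (h | ⟨h1, h2⟩) (k | ⟨k1, k2⟩)
          · exact Or.inl (h.trans k)
          · exact Or.inr ⟨k1.imp (·.trans h.symm) (·.trans h.symm), k2⟩
          · exact Or.inr ⟨h1, h2.imp (·.trans k) (·.trans k)⟩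
          · exact Or.inr ⟨h1, k2⟩ }
  have f2 : ∀ {x y}, SameCycle s' x y → SameCycle s x y ∨
      ((SameCycle s a x ∨ SameCycle s b x) ∧ (SameCycle s a y ∨ SameCycle s b y)) := by
    intro x y hxy
    refine rel_of_sameCycle (R := R) (fun x => ?_) hxy
    by_cases hxa : x = a
    · subst hxa; rw [ha]
      exact Or.inr ⟨Or.inl (SameCycle.refl _ _),
        Or.inr (sameCycle_apply_right.mpr (SameCycle.refl _ _))⟩
    by_cases hxb : x = b
    · subst hxb; rw [hb]
      exact Or.inr ⟨Or.inr (SameCycle.refl _ _),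
        Or.inl (sameCycle_apply_right.mpr (SameCycle.refl _ _))⟩
    · rw [hne x hxa hxb]; exact Or.inl (sameCycle_apply_right.mpr (SameCycle.refl _ _))
  let qb : Quotient (SameCycle.setoid s) := Quotient.mk _ b
  let g : {q : Quotient (SameCycle.setoid s) // q ≠ qb} → Quotient (SameCycle.setoid s') :=
    fun q => Quotient.map' (s₁ := SameCycle.setoid s) (s₂ := SameCycle.setoid s') id
      (fun _ _ h => f1 h) q.1
  have hg : Function.Bijective g := by
    constructor
    · rintro ⟨q1, h1⟩ ⟨q2, h2⟩ heq
      induction q1 using Quotient.inductionOn with | _ x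
      induction q2 using Quotient.inductionOn with | _ y
      have hx : ¬ SameCycle s b x := fun e => h1 (Quotient.sound e.symm)
      have hy : ¬ SameCycle s b y := fun e => h2 (Quotient.sound e.symm)
      have e : SameCycle s' x y := Quotient.exact heq
      apply Subtype.ext
      refine Quotient.sound ?_
      change SameCycle s x y
      rcases f2 e with e | ⟨e1, e2⟩
      · exact e
      · exact (e1.resolve_right hx).symm.trans (e2.resolve_right hy)
    · intro q
      induction q using Quotient.inductionOn with | _ x
      by_cases hx : SameCycle s b x
      · refine ⟨⟨Quotient.mk _ a, fun e => h (Quotient.exact e)⟩, Quotient.sound ?_⟩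
        exact hab.trans (f1 hx)
      · exact ⟨⟨Quotient.mk _ x, fun e => hx (SameCycle.symm (Quotient.exact e))⟩, rfl⟩
  classical
  have e1 := Nat.card_congr (Equiv.ofBijective g hg)
  have e2 := Nat.card_congr (Equiv.optionSubtypeNe qb)
  rw [Finite.card_option] at e2
  rw [cycleCount, cycleCount, ← e1, e2]

end CycleCount

/-! ### Exploration words and their shapes -/

/-- The steps of the exploration of a 4-valent planar map: discard an exhausted root vertex,
contract a root edge leading to a new vertex, or cut along a root edge that is a loop. -/
inductive ExplorationStep : Type
  | pop | join | split
  deriving DecidableEq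

open ExplorationStep

/-- `HasShape c ps n`: the word `c` explores a sequence of planar maps with root vertices of degrees
`ps` and `n` further vertices, all of degree 4. -/
inductive HasShape : List ExplorationStep → List ℕ → ℕ → Prop
  | nil : HasShape [] [] 0
  | pop {c ps n} : HasShape c ps n → HasShape (pop :: c) (0 :: ps) n
  | join {c p ps n} : HasShape c ((p + 3) :: ps) n → HasShape (join :: c) ((p + 1) :: ps) (n + 1)
  | split {c i j ps n} : HasShape c (i :: j :: ps) n → HasShape (split :: c) ((i + j + 2) :: ps) n

/-- Reading the word backwards reconstructs the degrees. This makes the sets of words for different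
splittings i + j disjoint in the count. -/
theorem HasShape.unique {c : List ExplorationStep} {ps qs : List ℕ} {n m : ℕ}
    (h : HasShape c ps n) (k : HasShape c qs m) : ps = qs ∧ n = m := by
  induction h generalizing qs m with
  | nil => cases k; exact ⟨rfl, rfl⟩
  | pop _ ih => cases k with | pop k => obtain ⟨rfl, rfl⟩ := ih k; exact ⟨rfl, rfl⟩
  | join _ ih =>
    cases k with
    | join k =>
      obtain ⟨h1, rfl⟩ := ih k
      simp only [List.cons.injEq, Nat.add_right_cancel_iff] at h1
      obtain ⟨rfl, rfl⟩ := h1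
      exact ⟨rfl, rfl⟩
  | split _ ih =>
    cases k with
    | split k =>
      obtain ⟨h1, rfl⟩ := ih k
      simp only [List.cons.injEq] at h1
      obtain ⟨rfl, rfl, rfl⟩ := h1
      exact ⟨rfl, rfl⟩

/-! ### Counting words by the recursion -/

section Counting
open PowerSeries

open Classical in
/-- The words of a given shape are counted by products of the series given by the root-edge
recursion. -/
theorem exists_finset_hasShape (a : ℕ → PowerSeries ℚ) (h0 : a 0 = 1)
    (hrec : ∀ p, a (p + 1) = (if p = 0 then 0 else
      ∑ ij ∈ Finset.HasAntidiagonal.antidiagonal (p - 1), a ij.1 * a ij.2) + X * a (p + 3))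
    (ps : List ℕ) (n : ℕ) :
    ∃ S : Finset (List ExplorationStep), (∀ c, c ∈ S ↔ HasShape c ps n) ∧
      (S.card : ℚ) = coeff n (ps.map a).prod := by
  -- The weight drops by 1 under a pop, by 4 under a join (degree +2, one vertex fewer), and by 3
  -- under a split (degree sum -2, one more root vertex).
  induction hN : 2 * (ps.sum + 4 * n) + ps.length using Nat.strong_induction_on
    generalizing ps n with
  | _ N ih =>
  rcases ps with _ | ⟨_ | p, ps⟩
  · rcases n with _ | n
    · refine ⟨{[]}, fun c => ?_, by simp⟩
      rw [Finset.mem_singleton]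
      constructor
      · rintro rfl; exact .nil
      · intro h; cases h; rfl
    · refine ⟨∅, fun c => ?_, ?_⟩
      · simp only [Finset.notMem_empty, false_iff]
        intro h; cases h
      · simp [coeff_one]
  · obtain ⟨S, hS, hc⟩ := ih _ (by simp at hN ⊢; omega) ps n rfl
    refine ⟨S.image (List.cons pop), fun c => ?_, ?_⟩
    · simp only [Finset.mem_image, hS]
      constructor
      · rintro ⟨c, hc, rfl⟩; exact .pop hc
      · intro h; cases h with | pop h => exact ⟨_, h, rfl⟩
    · rw [Finset.card_image_of_injective _ (List.cons_injective), hc]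
      simp [h0]
  · -- words starting with a join
    obtain ⟨J, hJ, hJc⟩ : ∃ J : Finset (List ExplorationStep),
        (∀ c, c ∈ J ↔ ∃ m, n = m + 1 ∧ HasShape c ((p + 3) :: ps) m) ∧
        (J.card : ℚ) = coeff n (X * (a (p + 3) * (ps.map a).prod)) := by
      rcases n with _ | n
      · exact ⟨∅, by simp, by simp⟩
      · obtain ⟨S, hS, hc⟩ := ih _ (by simp at hN ⊢; omega) ((p + 3) :: ps) n rfl
        refine ⟨S, fun c => ?_, ?_⟩
        · rw [hS]
          constructor
          · intro h; exact ⟨n, rfl, h⟩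
          · rintro ⟨m, hm, h⟩; obtain rfl : n = m := by omega
            exact h
        · rw [hc, coeff_succ_X_mul]; simp
    -- words starting with a split
    obtain ⟨K, hK, hKc⟩ : ∃ K : Finset (List ExplorationStep),
        (∀ c, c ∈ K ↔ ∃ i j, i + j + 1 = p ∧ HasShape c (i :: j :: ps) n) ∧
        (K.card : ℚ) = coeff n ((if p = 0 then 0 else
          ∑ ij ∈ Finset.HasAntidiagonal.antidiagonal (p - 1), a ij.1 * a ij.2) *
            (ps.map a).prod) := by
      rcases p with _ | p
      · exact ⟨∅, by simp, by simp⟩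
      · have hex : ∀ ij : ℕ × ℕ, ∃ S : Finset (List ExplorationStep), ij.1 + ij.2 = p →
            (∀ c, c ∈ S ↔ HasShape c (ij.1 :: ij.2 :: ps) n) ∧
            (S.card : ℚ) = coeff n (a ij.1 * a ij.2 * (ps.map a).prod) := by
          intro ij
          by_cases hij : ij.1 + ij.2 = p
          · obtain ⟨S, hS, hc⟩ := ih _ (by simp at hN ⊢; omega) (ij.1 :: ij.2 :: ps) n rfl
            exact ⟨S, fun _ => ⟨hS, by rw [hc]; simp [mul_assoc]⟩⟩
          · exact ⟨∅, fun h => absurd h hij⟩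
        choose F hF using hex
        refine ⟨(Finset.HasAntidiagonal.antidiagonal p).biUnion F, fun c => ?_, ?_⟩
        · simp only [Finset.mem_biUnion, Finset.HasAntidiagonal.mem_antidiagonal]
          constructor
          · rintro ⟨ij, hij, hc⟩
            exact ⟨ij.1, ij.2, by omega, ((hF ij hij).1 c).mp hc⟩
          · rintro ⟨i, j, hij, hc⟩
            have hij' : i + j = p := by omega
            exact ⟨(i, j), hij', ((hF (i, j) hij').1 c).mpr hc⟩
        · rw [Finset.card_biUnion, if_neg (Nat.succ_ne_zero p), Nat.add_sub_cancel,
            Finset.sum_mul, map_sum, Nat.cast_sum]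
          · refine Finset.sum_congr rfl fun ij hij => ?_
            exact (hF ij (Finset.HasAntidiagonal.mem_antidiagonal.mp hij)).2
          · intro ij hij kl hkl hne
            rw [Function.onFun, Finset.disjoint_left]
            intro c h1 h2
            have h1 := ((hF ij (Finset.HasAntidiagonal.mem_antidiagonal.mp hij)).1 c).mp h1
            have h2 := ((hF kl (Finset.HasAntidiagonal.mem_antidiagonal.mp hkl)).1 c).mp h2
            have := (h1.unique h2).1
            simp only [List.cons.injEq] at this
            exact hne (Prod.ext this.1 this.2.1)
    refine ⟨J.image (List.cons join) ∪ K.image (List.cons split), fun c => ?_, ?_⟩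
    · simp only [Finset.mem_union, Finset.mem_image, hJ, hK]
      constructor
      · rintro (⟨c, ⟨m, rfl, h⟩, rfl⟩ | ⟨c, ⟨i, j, rfl, h⟩, rfl⟩)
        · exact .join h
        · exact .split h
      · intro h
        generalize hq : p + 1 = q at h
        cases h with
        | join h =>
          obtain rfl := Nat.succ_injective hq
          exact Or.inl ⟨_, ⟨_, rfl, h⟩, rfl⟩
        | split h => exact Or.inr ⟨_, ⟨_, _, by omega, h⟩, rfl⟩
        | pop h => omega
    · rw [Finset.card_union_of_disjoint, Finset.card_image_of_injective _ (List.cons_injective),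
        Finset.card_image_of_injective _ (List.cons_injective), Nat.cast_add, hJc, hKc,
        List.map_cons, List.prod_cons, hrec p, ← map_add]
      · congr 1; ring
      · rw [Finset.disjoint_left]
        intro c h1 h2
        simp only [Finset.mem_image] at h1 h2
        obtain ⟨_, _, rfl⟩ := h1
        obtain ⟨_, _, h⟩ := h2
        simp at h

/-- By the recursion a_2 = 1 + t a_4. The shift of the exponent is the root vertex, which n does not
count. -/
theorem card_hasShape_four (n : ℕ) :
    (Nat.card {c // HasShape c [4] n} : ℚ) = coeff (n + 1) tutteGF := by
  obtain ⟨a, h0, h2, hrec⟩ := exists_rootDegree_series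
  obtain ⟨S, hS, hc⟩ := exists_finset_hasShape a h0 hrec [4] n
  have e : Nat.card {c // HasShape c [4] n} = S.card := by
    rw [Nat.card_congr (Equiv.subtypeEquivRight fun c => (hS c).symm)]
    simp
  have h := hrec 1
  rw [e, hc, ← h2, h]
  simp [h0, coeff_one, coeff_succ_X_mul]

end Counting

/-! ### Counting blossoming trees -/

section Blossoming
open BlossomingTree

theorem card_blossomingTree (n : ℕ) : Finite {t : BlossomingTree // t.innerNodes = n} ∧
    Nat.card {t : BlossomingTree // t.innerNodes = n} = 3 ^ n * catalan n := by
  induction n using Nat.strong_induction_on with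
  | _ n ih =>
  rcases n with _ | n
  · have : Unique {t : BlossomingTree // t.innerNodes = 0} :=
      { default := ⟨leaf, rfl⟩
        uniq := by
          rintro ⟨_ | ⟨f, l, r⟩, h⟩
          · rfl
          · simp [innerNodes] at h }
    exact ⟨inferInstance, by simp⟩
  · let P := Fin 3 × Σ ij : Fin (n + 1),
      {t : BlossomingTree // t.innerNodes = ij} × {t : BlossomingTree // t.innerNodes = n - ij}
    let e : {t : BlossomingTree // t.innerNodes = n + 1} ≃ P :=
      { toFun := fun t => match t with
          | ⟨node f l r, h⟩ => (f, ⟨⟨l.innerNodes, by simp [innerNodes] at h; omega⟩,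
              ⟨l, rfl⟩, ⟨r, by simp [innerNodes] at h ⊢; omega⟩⟩)
        invFun := fun x => ⟨node x.1 x.2.2.1.1 x.2.2.2.1, by
          have := x.2.1.2
          simp only [innerNodes, x.2.2.1.2, x.2.2.2.2]; omega⟩
        left_inv := by
          rintro ⟨_ | ⟨f, l, r⟩, h⟩
          · simp [innerNodes] at h
          · rfl
        right_inv := by
          rintro ⟨f, ⟨i, hi⟩, ⟨l, hl⟩, ⟨r, hr⟩⟩
          simp only at hl
          subst hl
          rfl }
    have hf : ∀ ij : Fin (n + 1), Finite ({t : BlossomingTree // t.innerNodes = ij} ×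
        {t : BlossomingTree // t.innerNodes = n - ij}) := fun ij =>
      have := (ih ij (by omega)).1
      have := (ih (n - ij) (by omega)).1
      inferInstance
    refine ⟨Finite.of_equiv _ e.symm, ?_⟩
    rw [Nat.card_congr e, Nat.card_prod, Nat.card_sigma, catalan_succ, pow_succ', mul_assoc,
      Nat.card_fin]
    congr 1
    rw [Finset.mul_sum]
    refine Finset.sum_congr rfl fun ij _ => ?_
    rw [Nat.card_prod, (ih ij (by omega)).2, (ih (n - ij) (by omega)).2]
    have : 3 ^ n = 3 ^ (ij : ℕ) * 3 ^ (n - ij) := by rw [← pow_add]; congr 1; omega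
    rw [this]; ring

theorem blossomingTreeGF_eq : blossomingTreeGF = ternaryCatalanGF := by
  ext n
  simp [blossomingTreeGF, ternaryCatalanGF, (card_blossomingTree n).2]

end Blossoming

/-! ### Cycles of a permutation as lists -/

section CyclicList
variable {D : Type*}

/-- The list is a cycle of the permutation, each entry being mapped to the next one. -/
def IsCyclicList (s : Perm D) : List D → Prop
  | [] => True
  | a :: l => (a :: (l ++ [a])).IsChain (fun x y => s x = y)

/-- A path may change its first entry and its permutation, provided the new first entry has the same
successor. This is how cycles are reconnected after multiplication by a transposition. -/
theorem isChain_congr {s s' : Perm D} {W : List D} {a b e : D}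
    (h : (a :: (W ++ [e])).IsChain (fun x y => s x = y)) (hb : s' b = s a)
    (hW : ∀ x ∈ W, s' x = s x) : (b :: (W ++ [e])).IsChain (fun x y => s' x = y) := by
  induction W generalizing a b with
  | nil => simp at h ⊢; rw [hb, h]
  | cons x W ih =>
    simp only [List.cons_append, List.isChain_cons_cons] at h ⊢
    exact ⟨hb.trans h.1, ih h.2 (hW x (by simp)) fun y hy => hW y (by simp [hy])⟩

theorem isChain_join {s : Perm D} {P Q : List D} {a b e : D}
    (h : (a :: (P ++ [b])).IsChain (fun x y => s x = y))
    (k : (b :: (Q ++ [e])).IsChain (fun x y => s x = y)) :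
    (a :: ((P ++ b :: Q) ++ [e])).IsChain (fun x y => s x = y) := by
  rw [List.append_assoc, List.cons_append, List.isChain_cons_split]
  exact ⟨h, k⟩

theorem isChain_split_cons {s : Perm D} {P Q : List D} {a b e : D}
    (h : (a :: ((P ++ b :: Q) ++ [e])).IsChain (fun x y => s x = y)) :
    (a :: (P ++ [b])).IsChain (fun x y => s x = y) ∧
      (b :: (Q ++ [e])).IsChain (fun x y => s x = y) := by
  rw [List.append_assoc, List.cons_append, List.isChain_cons_split] at h
  exact h

theorem IsCyclicList.rotate {s : Perm D} {P Q : List D} {r : D}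
    (h : IsCyclicList s (P ++ r :: Q)) : IsCyclicList s (r :: (Q ++ P)) := by
  cases P with
  | nil => simpa [IsCyclicList] using h
  | cons a P =>
    obtain ⟨h1, h2⟩ := isChain_split_cons h
    exact isChain_join h2 h1

theorem IsCyclicList.apply_mem {s : Perm D} {C : List D} (h : IsCyclicList s C) {x : D}
    (hx : x ∈ C) : s x ∈ C := by
  obtain ⟨P, Q, rfl⟩ := List.append_of_mem hx
  have h := h.rotate
  simp only [List.mem_append, List.mem_cons]
  rcases hQ : Q ++ P with _ | ⟨y, l⟩
  · rw [hQ] at h; simp only [IsCyclicList, List.nil_append, List.isChain_pair] at h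
    exact Or.inr (Or.inl h)
  · rw [hQ] at h; simp only [IsCyclicList, List.cons_append, List.isChain_cons_cons] at h
    have : y ∈ Q ++ P := by rw [hQ]; simp
    rw [h.1]
    rcases List.mem_append.mp this with h | h
    · exact Or.inr (Or.inr h)
    · exact Or.inl h

theorem IsCyclicList.congr {s s' : Perm D} {C : List D} (h : IsCyclicList s C)
    (hC : ∀ x ∈ C, s' x = s x) : IsCyclicList s' C := by
  cases C with
  | nil => trivial
  | cons a l => exact isChain_congr h (hC a (by simp)) fun x hx => hC x (by simp [hx])

theorem IsCyclicList.not_sameCycle [Finite D] {s : Perm D} {C : List D} (h : IsCyclicList s C)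
    {x y : D} (hx : x ∈ C) (hy : y ∉ C) : ¬ SameCycle s x y := fun e =>
  hy (mem_of_sameCycle (Y := {x | x ∈ C}) (fun _ hx => h.apply_mem hx) hx e)

end CyclicList

/-! ### Exploration of a map: states and their transitions -/

section Exploration
variable {D : Type*} [DecidableEq D]

/-- The first four iterates of a dart: the darts around its origin, if this vertex has degree 4. -/
def quad (σ : Perm D) (d : D) : Finset D := {d, σ d, σ (σ d), σ (σ (σ d))}

/-- `Explores σ α c ws U`: the word `c` describes the successful exploration of the map with root
vertices `ws` (lists of darts in cyclic order) whose other darts are those of `U`. -/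
inductive Explores (σ α : Perm D) : List ExplorationStep → List (List D) → Finset D → Prop
  | nil : Explores σ α [] [] ∅
  | pop {c ws U} : Explores σ α c ws U → Explores σ α (pop :: c) ([] :: ws) U
  | join {c r w ws U} : α r ∈ U → α r ∉ w →
      Explores σ α c ((σ (α r) :: σ (σ (α r)) :: σ (σ (σ (α r))) :: w) :: ws) (U \ quad σ (α r)) →
      Explores σ α (join :: c) ((r :: w) :: ws) U
  | split {c r w w₁ w₂ ws U} : w = w₁ ++ α r :: w₂ → α r ∉ w₁ →
      Explores σ α c (w₁ :: w₂ :: ws) U → Explores σ α (split :: c) ((r :: w) :: ws) U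

/-- At each step the letter is forced by whether the first pending list is empty, and otherwise by
whether it contains the partner of its first dart. A split is unambiguous because the partner does
not occur in the part before it. -/
theorem Explores.unique {σ α : Perm D} {c c' : List ExplorationStep} {ws : List (List D)}
    {U U' : Finset D} (h : Explores σ α c ws U) (h' : Explores σ α c' ws U') : c = c' := by
  induction h generalizing c' U' with
  | nil => cases h'; rfl
  | pop _ ih => cases h' with | pop h' => rw [ih h']
  | join h1 h2 _ ih =>
    cases h' with
    | join k1 k2 k => rw [ih k]
    | split hw _ _ => exact absurd (by rw [hw]; simp) h2
  | @split c r w w₁ w₂ ws U hw hn _ ih =>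
    cases h' with
    | join k1 k2 k => exact absurd (by rw [hw]; simp) k2
    | @split c' _ _ v₁ v₂ _ _ kw kn k =>
      have : w₁ = v₁ ∧ w₂ = v₂ := by
        rw [hw] at kw
        have := List.append_eq_append_iff.mp kw
        rcases this with ⟨l, e1, e2⟩ | ⟨l, e1, e2⟩
        · rcases l with _ | ⟨a, l⟩
          · simp at e1 e2; exact ⟨e1.symm, e2⟩
          · simp at e2; subst e1; exact absurd (by simp [e2.1]) kn
        · rcases l with _ | ⟨a, l⟩
          · simp at e1 e2; exact ⟨e1, e2.symm⟩
          · simp at e2; subst e1; exact absurd (by simp [e2.1]) hn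
      obtain ⟨rfl, rfl⟩ := this
      rw [ih k]

/-- The entries of each list which belong to `X`. -/
def live (X : Finset D) (Cs : List (List D)) : List (List D) :=
  Cs.map (List.filter (· ∈ X))

/-- A state in the exploration of `(σ, α)`: the cycles of `s` listed in `Cs` have replaced the
vertices already explored, those of `σ` in `U` are still to be explored, and the edges still to be
used are those with darts in `X`; they are exchanged by `A`. -/
structure IsState (σ α s A : Perm D) (Cs : List (List D)) (X U : Finset D) : Prop where
  nodup : Cs.flatten.Nodup
  cyclic : ∀ C ∈ Cs, IsCyclicList s C
  subset : U ⊆ X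
  cover : ∀ x ∈ X, x ∈ Cs.flatten ∨ x ∈ U
  disj : ∀ x ∈ U, x ∉ Cs.flatten
  apply_eq : ∀ x ∈ U, s x = σ x
  closed : ∀ x ∈ U, σ x ∈ U
  closed' : ∀ x ∈ X, α x ∈ X
  eq_on : ∀ x ∈ X, A x = α x
  eq_off : ∀ x ∉ X, A x = x

variable {σ α s A : Perm D} {Cs : List (List D)} {X U : Finset D}

omit [DecidableEq D] in
theorem IsState.perm {Cs' : List (List D)} (h : IsState σ α s A Cs X U) (hp : Cs.Perm Cs') :
    IsState σ α s A Cs' X U :=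
  { h with
    nodup := hp.flatten.nodup_iff.mp h.nodup
    cyclic := fun C hC => h.cyclic C (hp.mem_iff.mpr hC)
    cover := fun x hx => (h.cover x hx).imp_left hp.flatten.mem_iff.mp
    disj := fun x hx hn => h.disj x hx (hp.flatten.mem_iff.mpr hn) }

theorem IsState.rotate {P Q : List D} {r : D} (h : IsState σ α s A ((P ++ r :: Q) :: Cs) X U) :
    IsState σ α s A ((r :: (Q ++ P)) :: Cs) X U := by
  have hp : ((P ++ r :: Q) :: Cs).flatten.Perm ((r :: (Q ++ P)) :: Cs).flatten := by
    rw [List.perm_iff_count]; intro a; simp [List.count_cons]; omega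
  exact { h with
    nodup := hp.nodup_iff.mp h.nodup
    cyclic := by
      intro C hC
      rcases List.mem_cons.mp hC with rfl | hC
      · exact (h.cyclic _ (by simp)).rotate
      · exact h.cyclic C (by simp [hC])
    cover := fun x hx => (h.cover x hx).imp_left hp.mem_iff.mp
    disj := fun x hx hn => h.disj x hx (hp.mem_iff.mpr hn) }

theorem IsState.pop {C : List D} (h : IsState σ α s A (C :: Cs) X U)
    (hC : C.filter (· ∈ X) = []) : IsState σ α s A Cs X U := by
  have hd : ∀ x ∈ X, x ∉ C := by
    intro x hx hxC
    have : x ∈ C.filter (· ∈ X) := by simp [hx, hxC]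
    rw [hC] at this; simp at this
  exact { h with
    nodup := by have := h.nodup; rw [List.flatten_cons] at this; exact this.of_append_right
    cyclic := fun C' hC' => h.cyclic C' (by simp [hC'])
    cover := fun x hx => by
      have := h.cover x hx
      rw [List.flatten_cons, List.mem_append] at this
      have := hd x hx
      tauto
    disj := fun x hx hn => h.disj x hx (by rw [List.flatten_cons]; simp [hn]) }

/-- Bringing the first live dart to the front. -/
theorem IsState.exists_head {r : D} {w : List D} {ws : List (List D)}
    (h : IsState σ α s A Cs X U) (hw : live X Cs = (r :: w) :: ws) :
    ∃ Q Cs', IsState σ α s A ((r :: Q) :: Cs') X U ∧ r ∈ X ∧ Q.filter (· ∈ X) = w ∧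
      live X Cs' = ws ∧
      Cs.length = Cs'.length + 1 := by
  rcases Cs with _ | ⟨C, Cs⟩
  · simp [live] at hw
  simp only [live, List.map_cons, List.cons.injEq] at hw
  obtain ⟨P, Q, rfl, hP, hr, hQ⟩ := List.filter_eq_cons_iff.mp hw.1
  have hP' : P.filter (· ∈ X) = [] := List.filter_eq_nil_iff.mpr hP
  exact ⟨Q ++ P, Cs, h.rotate, by simpa using hr, by simp [hP', hQ], hw.2, rfl⟩


theorem filter_sdiff_pair {r d : D} {l : List D} (hr : r ∉ l) (hd : d ∉ l) :
    l.filter (· ∈ X \ {r, d}) = l.filter (· ∈ X) := by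
  refine List.filter_congr fun x hx => ?_
  have h1 : x ≠ r := fun e => hr (e ▸ hx)
  have h2 : x ≠ d := fun e => hd (e ▸ hx)
  simp [h1, h2]

theorem live_sdiff_pair {r d : D} (hr : r ∉ Cs.flatten) (hd : d ∉ Cs.flatten) :
    live (X \ {r, d}) Cs = live X Cs := by
  refine List.map_congr_left fun C hC => ?_
  exact filter_sdiff_pair (fun h => hr (List.mem_flatten.mpr ⟨C, hC, h⟩))
    (fun h => hd (List.mem_flatten.mpr ⟨C, hC, h⟩))

/-- Using up the edge {r, d} leaves the product, whose cycles are the faces, unchanged. -/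
theorem mul_swap_mul_swap_mul (s A : Perm D) (r d : D) :
    (s * swap r d) * (swap r d * A) = s * A := by
  rw [mul_assoc, ← mul_assoc (swap r d), swap_mul_self, one_mul]

variable {r d : D} (hα : ∀ x, α (α x) = x) (hd : α r = d)

include hα hd in
/-- The bookkeeping common to all ways of using an edge. -/
theorem IsState.use_edge {Cs' : List (List D)} {U' : Finset D} (h : IsState σ α s A Cs X U)
    (hr : r ∈ X)
    (nodup : Cs'.flatten.Nodup)
    (cyclic : ∀ C ∈ Cs', IsCyclicList (s * swap r d) C)
    (hU : U' ⊆ U) (hrU : r ∉ U') (hdU : d ∉ U')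
    (cover : ∀ x ∈ X, x ∈ Cs'.flatten ∨ x ∈ U')
    (disj : ∀ x ∈ U', x ∉ Cs'.flatten)
    (closed : ∀ x ∈ U', σ x ∈ U') :
    IsState σ α (s * swap r d) (swap r d * A) Cs' (X \ {r, d}) U' := by
  have hd' : α d = r := by rw [← hd, hα]
  refine ⟨nodup, cyclic, ?_, ?_, disj, ?_, closed, ?_, ?_, ?_⟩
  · intro x hx
    have h1 : x ≠ r := fun e => hrU (e ▸ hx)
    have h2 : x ≠ d := fun e => hdU (e ▸ hx)
    simp [h1, h2, h.subset (hU hx)]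
  · intro x hx
    exact cover x (Finset.mem_sdiff.mp hx).1
  · intro x hx
    have h1 : x ≠ r := fun e => hrU (e ▸ hx)
    have h2 : x ≠ d := fun e => hdU (e ▸ hx)
    rw [Perm.mul_apply, swap_apply_of_ne_of_ne h1 h2, h.apply_eq x (hU hx)]
  · intro x hx
    simp only [Finset.mem_sdiff, Finset.mem_insert, Finset.mem_singleton, not_or] at hx ⊢
    refine ⟨h.closed' x hx.1, fun e => hx.2.2 ?_, fun e => hx.2.1 ?_⟩
    · rw [← hα x, e, hd]
    · rw [← hα x, e, hd']
  · intro x hx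
    simp only [Finset.mem_sdiff, Finset.mem_insert, Finset.mem_singleton, not_or] at hx
    rw [Perm.mul_apply, h.eq_on x hx.1, swap_apply_of_ne_of_ne]
    · intro e; apply hx.2.2; rw [← hα x, e, hd]
    · intro e; apply hx.2.1; rw [← hα x, e, hd']
  · intro x hx
    rw [Perm.mul_apply]
    by_cases h1 : x = r
    · subst h1; rw [h.eq_on x hr, hd, swap_apply_right]
    by_cases h2 : x = d
    · subst h2
      rw [h.eq_on x (hd ▸ h.closed' r hr), hd', swap_apply_left]
    · have : x ∉ X := fun hX => hx (by simp [hX, h1, h2])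
      rw [h.eq_off x this, swap_apply_of_ne_of_ne h1 h2]

theorem IsCyclicList.mul_swap {C : List D} (h : IsCyclicList s C) (h1 : r ∉ C) (h2 : d ∉ C) :
    IsCyclicList (s * swap r d) C :=
  h.congr fun x hx => by
    rw [Perm.mul_apply, swap_apply_of_ne_of_ne (by rintro rfl; exact h1 hx)
      (by rintro rfl; exact h2 hx)]

-- A loop cuts its cycle in two. The used darts r and d stay in the lists as dead placeholders,
-- which `live` ignores.
include hα hd in
theorem IsState.split {W₁ W₂ : List D} (h : IsState σ α s A ((r :: (W₁ ++ d :: W₂)) :: Cs) X U)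
    (hr : r ∈ X) :
    IsState σ α (s * swap r d) (swap r d * A) ((d :: W₁) :: (r :: W₂) :: Cs) (X \ {r, d}) U := by
  have hn := h.nodup
  have hp : ((r :: (W₁ ++ d :: W₂)) :: Cs).flatten.Perm
      ((d :: W₁) :: (r :: W₂) :: Cs).flatten := by
    rw [List.perm_iff_count]; intro a; simp [List.count_cons]; omega
  refine h.use_edge hα hd hr (hp.nodup_iff.mp hn) ?_ subset_rfl ?_ ?_ ?_ ?_ h.closed
  · obtain ⟨c1, c2⟩ := isChain_split_cons (h.cyclic (r :: (W₁ ++ d :: W₂)) (by simp))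
    simp only [List.flatten_cons, List.cons_append, List.append_assoc, List.nodup_cons,
      List.nodup_append, List.mem_append, List.mem_cons, not_or] at hn
    have hW : ∀ W : List D, (r ∉ W) → (d ∉ W) → ∀ x ∈ W, (s * swap r d) x = s x := by
      intro W h1 h2 x hx
      rw [Perm.mul_apply, swap_apply_of_ne_of_ne (by rintro rfl; exact h1 hx)
        (by rintro rfl; exact h2 hx)]
    intro C hC
    simp only [List.mem_cons] at hC
    rcases hC with rfl | rfl | hC
    · exact isChain_congr c1 (by simp) (hW _ (by tauto) (by grind))
    · exact isChain_congr c2 (by simp) (hW _ (by tauto) (by grind))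
    · refine (h.cyclic C (by simp [hC])).mul_swap ?_ ?_
      · intro hx
        exact hn.1.2.2.2 (List.mem_flatten.mpr ⟨C, hC, hx⟩)
      · intro hx
        have := List.mem_flatten.mpr ⟨C, hC, hx⟩
        grind
  · exact fun hx => h.disj r hx (by simp)
  · exact fun hx => h.disj d hx (by simp)
  · exact fun x hx => (h.cover x hx).imp_left hp.mem_iff.mp
  · exact fun x hx hn => h.disj x hx (hp.mem_iff.mpr hn)

omit [DecidableEq D] in
theorem nodup_quad (h4 : ∀ x, σ (σ (σ (σ x))) = x) (h2 : ∀ x, σ (σ x) ≠ x) (d : D) :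
    [d, σ d, σ (σ d), σ (σ (σ d))].Nodup := by
  have h1 : ∀ x, σ x ≠ x := fun x e => h2 x (by rw [e, e])
  have e3 : σ (σ (σ d)) ≠ d := fun e => h1 d (by
    have := h4 d
    rwa [e] at this)
  have a1 := h1 d
  have a2 := h2 d
  have a3 := h1 (σ d)
  have a4 := h2 (σ d)
  have a5 := h1 (σ (σ d))
  simp only [List.nodup_cons, List.mem_cons, List.not_mem_nil, or_false, not_or]
  exact ⟨⟨a1.symm, a2.symm, e3.symm⟩, ⟨a3.symm, a4.symm⟩, a5.symm, by simp, by simp⟩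

theorem mem_quad_apply (h4 : ∀ x ∈ U, σ (σ (σ (σ x))) = x) (hdU : d ∈ U) {x : D} :
    σ x ∈ quad σ d ↔ x ∈ quad σ d := by
  have h := h4 d hdU
  simp only [quad, Finset.mem_insert, Finset.mem_singleton, EmbeddingLike.apply_eq_iff_eq]
  constructor
  · rintro (e | e | e | e)
    · right; right; right; apply σ.injective; rw [e, h]
    all_goals simp [e]
  · rintro (e | e | e | e)
    · simp [e]
    · simp [e]
    · simp [e]
    · left; rw [e, h]

-- The cycle of the new vertex is inserted right after r, with d placed last. The live darts are
-- then the other three darts of the new vertex followed by the old ones, as in `Explores.join`.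
include hα hd in
theorem IsState.join {Q : List D} (h : IsState σ α s A ((r :: Q) :: Cs) X U)
    (hr : r ∈ X) (hdU : d ∈ U) (h4 : ∀ x, σ (σ (σ (σ x))) = x) (h2 : ∀ x, σ (σ x) ≠ x) :
    IsState σ α (s * swap r d) (swap r d * A)
      ((r :: (([σ d, σ (σ d), σ (σ (σ d))] ++ d :: Q))) :: Cs) (X \ {r, d}) (U \ quad σ d) := by
  have hn := h.nodup
  have m1 := h.closed d hdU
  have m2 := h.closed _ m1
  have m3 := h.closed _ m2
  have hU : ∀ x ∈ quad σ d, x ∈ U := by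
    intro x hx
    simp only [quad, Finset.mem_insert, Finset.mem_singleton] at hx
    rcases hx with rfl | rfl | rfl | rfl <;> assumption
  have hrU : r ∉ U := fun hx => h.disj r hx (by simp)
  have hn' := nodup_quad h4 h2 d
  have hp : ((r :: (([σ d, σ (σ d), σ (σ (σ d))] ++ d :: Q))) :: Cs).flatten.Perm
      ([d, σ d, σ (σ d), σ (σ (σ d))] ++ ((r :: Q) :: Cs).flatten) := by
    rw [List.perm_iff_count]; intro a; simp [List.count_cons]; omega
  have hmem : ∀ x, x ∈ [d, σ d, σ (σ d), σ (σ (σ d))] ↔ x ∈ quad σ d := by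
    intro x; simp [quad]
  have hdn : d ∉ ((r :: Q) :: Cs).flatten := h.disj d hdU
  refine h.use_edge hα hd hr (hp.nodup_iff.mpr ?_) ?_ Finset.sdiff_subset
    (fun hx => hrU (Finset.sdiff_subset hx)) (fun hx => ?_) ?_ ?_ ?_
  · exact List.nodup_append.mpr ⟨hn', hn, fun x hx y hy e =>
      h.disj x (hU x ((hmem x).mp hx)) (e ▸ hy)⟩
  · intro C hC
    rcases List.mem_cons.mp hC with rfl | hC
    · have c := h.cyclic (r :: Q) (by simp)
      refine isChain_join ?_ (isChain_congr c (by simp) fun x hx => ?_)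
      · have e1 : ∀ x ∈ U, x ≠ d → (s * swap r d) x = σ x := fun x hx hxd => by
          rw [Perm.mul_apply, swap_apply_of_ne_of_ne (by rintro rfl; exact hrU hx) hxd,
            h.apply_eq x hx]
        simp only [List.nodup_cons, List.mem_cons, List.not_mem_nil, or_false, not_or] at hn'
        simp only [List.cons_append, List.nil_append, List.isChain_cons_cons,
          List.isChain_singleton, and_true]
        refine ⟨by simp [h.apply_eq d hdU], e1 _ m1 (Ne.symm hn'.1.1), e1 _ m2 (Ne.symm hn'.1.2.1),
          by rw [e1 _ m3 (Ne.symm hn'.1.2.2), h4]⟩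
      · rw [Perm.mul_apply, swap_apply_of_ne_of_ne]
        · rintro rfl
          simp only [List.flatten_cons, List.cons_append, List.nodup_cons, List.mem_append,
            not_or] at hn
          exact hn.1.1 hx
        · rintro rfl
          exact hdn (by simp [hx])
    · refine (h.cyclic C (by simp [hC])).mul_swap ?_ ?_
      · intro hx
        have := List.mem_flatten.mpr ⟨C, hC, hx⟩
        simp only [List.flatten_cons, List.cons_append, List.nodup_cons, List.mem_append,
            not_or] at hn
        exact hn.1.2 this
      · intro hx
        exact hdn (List.mem_flatten.mpr ⟨C, by simp [hC], hx⟩)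
  · exact (Finset.mem_sdiff.mp hx).2 (by simp [quad])
  · intro x hx
    rw [hp.mem_iff, List.mem_append, hmem, Finset.mem_sdiff]
    have := h.cover x hx
    tauto
  · intro x hx hc
    rw [hp.mem_iff, List.mem_append, hmem] at hc
    rw [Finset.mem_sdiff] at hx
    exact hc.elim hx.2 (h.disj x hx.1)
  · intro x hx
    rw [Finset.mem_sdiff] at hx ⊢
    exact ⟨h.closed x hx.1, fun e => hx.2 ((mem_quad_apply (U := U) (fun x _ => h4 x) hdU).mp e)⟩

-- This is the case of an edge between two pending root vertices, absent from `Explores`; it signals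
-- a handle.
include hα hd in
theorem IsState.merge {Q R : List D} (h : IsState σ α s A ((r :: Q) :: (d :: R) :: Cs) X U)
    (hr : r ∈ X) :
    IsState σ α (s * swap r d) (swap r d * A) ((r :: (R ++ d :: Q)) :: Cs) (X \ {r, d}) U := by
  have hn := h.nodup
  have hp : ((r :: Q) :: (d :: R) :: Cs).flatten.Perm
      ((r :: (R ++ d :: Q)) :: Cs).flatten := by
    rw [List.perm_iff_count]; intro a; simp [List.count_cons]; omega
  refine h.use_edge hα hd hr (hp.nodup_iff.mp hn) ?_ subset_rfl ?_ ?_ ?_ ?_ h.closed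
  · have c1 := h.cyclic (r :: Q) (by simp)
    have c2 := h.cyclic (d :: R) (by simp)
    simp only [List.flatten_cons, List.cons_append, List.nodup_cons,
      List.nodup_append, List.mem_append, List.mem_cons, not_or] at hn
    have hW : ∀ W : List D, (r ∉ W) → (d ∉ W) → ∀ x ∈ W, (s * swap r d) x = s x := by
      intro W h1 h2 x hx
      rw [Perm.mul_apply, swap_apply_of_ne_of_ne (by rintro rfl; exact h1 hx)
        (by rintro rfl; exact h2 hx)]
    intro C hC
    simp only [List.mem_cons] at hC
    rcases hC with rfl | hC
    · refine isChain_join (isChain_congr c2 (by simp) (hW _ (by tauto) (by grind)))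
        (isChain_congr c1 (by simp) (hW _ (by tauto) (by grind)))
    · refine (h.cyclic C (by simp [hC])).mul_swap ?_ ?_
      · intro hx
        have := List.mem_flatten.mpr ⟨C, hC, hx⟩
        grind
      · intro hx
        have := List.mem_flatten.mpr ⟨C, hC, hx⟩
        grind
  · exact fun hx => h.disj r hx (by simp)
  · exact fun hx => h.disj d hx (by simp)
  · exact fun x hx => (h.cover x hx).imp_left hp.mem_iff.mp
  · exact fun x hx hn => h.disj x hx (hp.mem_iff.mpr hn)

end Exploration

/-! ### Faces counted along the exploration -/

section Exploration
variable {D : Type*} [DecidableEq D] {σ α s A : Perm D} {Cs : List (List D)} {X U : Finset D}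
  {r d : D}

theorem IsState.live_split {W₁ W₂ : List D}
    (h : IsState σ α s A ((r :: (W₁ ++ d :: W₂)) :: Cs) X U) :
    live (X \ {r, d}) ((d :: W₁) :: (r :: W₂) :: Cs) =
      W₁.filter (· ∈ X) :: W₂.filter (· ∈ X) :: live X Cs := by
  have hn := h.nodup
  simp only [List.flatten_cons, List.cons_append, List.append_assoc, List.nodup_cons,
    List.nodup_append, List.mem_append, List.mem_cons, not_or] at hn
  rw [← live_sdiff_pair (X := X) (Cs := Cs) (r := r) (d := d) (by grind) (by grind),
    ← filter_sdiff_pair (X := X) (l := W₁) (r := r) (d := d) (by grind) (by grind),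
    ← filter_sdiff_pair (X := X) (l := W₂) (r := r) (d := d) (by grind) (by grind)]
  simp [live]

theorem IsState.live_join {Q : List D} (h : IsState σ α s A ((r :: Q) :: Cs) X U)
    (hdU : d ∈ U) (h4 : ∀ x, σ (σ (σ (σ x))) = x) (h2 : ∀ x, σ (σ x) ≠ x) :
    live (X \ {r, d}) ((r :: (([σ d, σ (σ d), σ (σ (σ d))] ++ d :: Q))) :: Cs) =
      (σ d :: σ (σ d) :: σ (σ (σ d)) :: Q.filter (· ∈ X)) :: live X Cs := by
  have hn := h.nodup
  have hdn : d ∉ ((r :: Q) :: Cs).flatten := h.disj d hdU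
  have hrU : r ∉ U := fun hx => h.disj r hx (by simp)
  have hq := nodup_quad h4 h2 d
  simp only [List.flatten_cons, List.cons_append, List.nodup_cons,
    List.nodup_append, List.mem_append, List.mem_cons, not_or] at hn hdn hq
  rw [← live_sdiff_pair (X := X) (Cs := Cs) (r := r) (d := d) (by grind) (by grind),
    ← filter_sdiff_pair (X := X) (l := Q) (r := r) (d := d) (by grind) (by grind)]
  have m1 := h.closed d hdU
  have m2 := h.closed _ m1
  have m3 := h.closed _ m2
  have f : ∀ x ∈ U, x ≠ d → x ∈ X \ {r, d} := by
    intro x hx hxd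
    have : x ≠ r := fun e => hrU (e ▸ hx)
    simp [this, hxd, h.subset hx]
  have e1 := f _ m1 (Ne.symm hq.1.1)
  have e2 := f _ m2 (Ne.symm hq.1.2.1)
  have e3 := f _ m3 (Ne.symm hq.1.2.2.1)
  have er : r ∉ X \ {r, d} := by simp
  have ed : d ∉ X \ {r, d} := by simp
  simp only [live, List.map_cons, List.filter_cons, List.cons_append, List.nil_append, e1, e2, e3,
    er, ed, decide_true, decide_false, if_true, Bool.false_eq_true, if_false]

theorem length_filter_flatten (X : Finset D) (Cs : List (List D)) :
    (Cs.flatten.filter (· ∈ X)).length = (live X Cs).flatten.length := by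
  rw [live, List.filter_flatten]

variable [Finite D]

/-- After the split r and d lie in different cycles, and the same transposition merges them back. -/
theorem IsState.cycleCount_split {W₁ W₂ : List D}
    (hα : ∀ x, α (α x) = x) (hd : α r = d)
    (h : IsState σ α s A ((r :: (W₁ ++ d :: W₂)) :: Cs) X U) (hr : r ∈ X) :
    cycleCount (s * swap r d) = cycleCount s + 1 := by
  have hs := h.split hα hd hr
  have hn := hs.nodup
  have := (hs.cyclic (r :: W₂) (by simp)).not_sameCycle (x := r) (y := d) (by simp) (by
    simp only [List.flatten_cons, List.cons_append, List.nodup_cons,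
      List.nodup_append, List.mem_append, List.mem_cons, not_or] at hn ⊢
    grind)
  have := cycleCount_mul_swap this
  rw [mul_assoc, swap_mul_self, mul_one] at this
  omega

theorem IsState.cycleCount_join {Q : List D} (h : IsState σ α s A ((r :: Q) :: Cs) X U)
    (hd : d ∉ r :: Q) : cycleCount (s * swap r d) + 1 = cycleCount s :=
  cycleCount_mul_swap ((h.cyclic (r :: Q) (by simp)).not_sameCycle (by simp) hd)

omit [Finite D] in
theorem card_sdiff_pair {r d : D} (hr : r ∈ X) (hd : d ∈ X) (hne : d ≠ r) :
    (X \ {r, d}).card + 2 = X.card := by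
  rw [← Finset.card_sdiff_add_card_eq_card (s := {r, d}) (t := X), Finset.card_pair hne.symm]
  intro x hx
  simp only [Finset.mem_insert, Finset.mem_singleton] at hx
  rcases hx with rfl | rfl <;> assumption

/-- The number of faces is bounded in terms of the current state, and in case of equality the
exploration succeeds. -/
theorem IsState.cycleCount_le (hα : ∀ x, α (α x) = x) (hne : ∀ x, α x ≠ x)
    (h4 : ∀ x, σ (σ (σ (σ x))) = x) (h2 : ∀ x, σ (σ x) ≠ x)
    (hconn : ∀ Y : Finset D, Y ⊆ U → (∀ x ∈ Y, σ x ∈ Y) → (∀ x ∈ Y, α x ∈ Y) → Y = ∅)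
    (h : IsState σ α s A Cs X U) :
    2 * cycleCount (s * A) ≤ 2 * cycleCount s + (live X Cs).flatten.length ∧
    (2 * cycleCount (s * A) = 2 * cycleCount s + (live X Cs).flatten.length →
      ∃ c, Explores σ α c (live X Cs) U) := by
  induction hN : X.card + Cs.length using Nat.strong_induction_on
    generalizing s A Cs X U with
  | _ N ih =>
  rcases hl : live X Cs with _ | ⟨_ | ⟨r, w⟩, ws⟩
  · have hCs : Cs = [] := by simpa [live] using hl
    subst hCs
    -- With no pending root vertex left, the remaining darts are closed under σ and α, so
    -- connectedness leaves none.
    have hXU : X = U := Finset.Subset.antisymm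
      (fun x hx => (h.cover x hx).resolve_left (by simp)) h.subset
    subst hXU
    have hX : X = ∅ := hconn X subset_rfl h.closed h.closed'
    subst hX
    have : A = 1 := Perm.ext fun x => h.eq_off x (by simp)
    subst this
    simp only [mul_one, List.flatten_nil, List.length_nil, add_zero, le_refl, true_and]
    exact fun _ => ⟨[], .nil⟩
  · rcases Cs with _ | ⟨C, Cs⟩
    · simp [live] at hl
    simp only [live, List.map_cons, List.cons.injEq] at hl
    obtain ⟨i1, i2⟩ := ih _ (by simp at hN; omega) hconn (h.pop hl.1) rfl
    have e : live X Cs = ws := hl.2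
    rw [e] at i1 i2
    refine ⟨by simpa using i1, fun hc => ?_⟩
    obtain ⟨c, hc⟩ := i2 (by simpa using hc)
    exact ⟨_, hc.pop⟩
  · obtain ⟨Q, Cs', h, hr, hQ, hws, hlen⟩ := h.exists_head hl
    obtain ⟨d, hd⟩ : ∃ d, α r = d := ⟨_, rfl⟩
    have hdX : d ∈ X := hd ▸ h.closed' r hr
    have hdr : d ≠ r := hd ▸ hne r
    have hcard := card_sdiff_pair hr hdX hdr
    rw [← mul_swap_mul_swap_mul s A r d]
    by_cases hdQ : d ∈ Q
    · obtain ⟨W₁, W₂, rfl⟩ := List.append_of_mem hdQ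
      have hc := h.cycleCount_split hα hd hr
      obtain ⟨i1, i2⟩ := ih _ (by simp at hN ⊢; omega) hconn (h.split hα hd hr) rfl
      rw [h.live_split, hws, hc] at i1 i2
      have hw : w = W₁.filter (· ∈ X) ++ d :: W₂.filter (· ∈ X) := by
        rw [← hQ]; simp [hdX]
      have hL : ((r :: w) :: ws).flatten.length =
          (W₁.filter (· ∈ X) :: W₂.filter (· ∈ X) :: ws).flatten.length + 2 := by
        rw [hw]; simp; omega
      rw [hL]
      refine ⟨by omega, fun he => ?_⟩
      obtain ⟨c, hc⟩ := i2 (by omega)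
      refine ⟨_, hc.split (hd.symm ▸ hw) ?_⟩
      intro hm
      have hn := h.nodup
      simp only [List.flatten_cons, List.cons_append, List.append_assoc, List.nodup_cons,
        List.nodup_append, List.mem_append, List.mem_cons, not_or] at hn
      have := (List.mem_filter.mp hm).1
      rw [hd] at this
      grind
    by_cases hdU : d ∈ U
    · have hc := h.cycleCount_join (d := d) (by simp [hdr, hdQ])
      obtain ⟨i1, i2⟩ := ih _ (by simp at hN ⊢; omega)
        (fun Y hY => hconn Y (hY.trans Finset.sdiff_subset)) (h.join hα hd hr hdU h4 h2) rfl
      rw [h.live_join hdU h4 h2, hws, hQ] at i1 i2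
      have hL : ((σ d :: σ (σ d) :: σ (σ (σ d)) :: w) :: ws).flatten.length =
          ((r :: w) :: ws).flatten.length + 2 := by simp
      rw [hL] at i1 i2
      refine ⟨by omega, fun he => ?_⟩
      obtain ⟨c, hc⟩ := i2 (by omega)
      subst hd
      refine ⟨_, hc.join hdU fun hm => hdQ ?_⟩
      rw [← hQ] at hm
      exact (List.mem_filter.mp hm).1
    -- The handle case: a cycle is lost and no live dart is gained, so the bound becomes strict and
    -- equality is impossible.
    · have hdC : d ∈ Cs'.flatten := by
        have := h.cover d hdX
        simp only [List.flatten_cons, List.cons_append, List.mem_cons, List.mem_append] at this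
        tauto
      obtain ⟨C, hC, hdC'⟩ := List.mem_flatten.mp hdC
      obtain ⟨L₁, L₂, rfl⟩ := List.append_of_mem hC
      obtain ⟨P, R, rfl⟩ := List.append_of_mem hdC'
      have hp : ((r :: Q) :: (L₁ ++ (P ++ d :: R) :: L₂)).Perm
          ((P ++ d :: R) :: (r :: Q) :: (L₁ ++ L₂)) :=
        (List.perm_middle.cons _).trans (List.Perm.swap _ _ _)
      have k := ((h.perm hp).rotate).perm (List.Perm.swap _ _ _)
      have hc := k.cycleCount_join (d := d) (by simp [hdr, hdQ])
      obtain ⟨i1, -⟩ := ih _ (by simp at hN hlen ⊢; omega) hconn (k.merge hα hd hr) rfl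
      have hle : (live (X \ {r, d}) ((r :: ((R ++ P) ++ d :: Q)) :: (L₁ ++ L₂))).flatten.length ≤
          ((r :: w) :: ws).flatten.length := by
        rw [← hws, ← hQ, ← length_filter_flatten]
        have : ((r :: Q.filter (· ∈ X)) :: live X (L₁ ++ (P ++ d :: R) :: L₂)) =
            live X ((r :: Q) :: (L₁ ++ (P ++ d :: R) :: L₂)) := by simp [live, hr]
        rw [this, ← length_filter_flatten]
        have hp2 : ((r :: ((R ++ P) ++ d :: Q)) :: (L₁ ++ L₂)).flatten.Perm
            ((r :: Q) :: (L₁ ++ (P ++ d :: R) :: L₂)).flatten := by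
          rw [List.perm_iff_count]; intro a; simp [List.count_cons]; omega
        rw [(hp2.filter _).length_eq]
        refine List.Sublist.length_le (List.monotone_filter_right _ fun x => ?_)
        simp only [Finset.mem_sdiff, decide_eq_true_eq]
        exact fun hx => hx.1
      exact ⟨by omega, fun he => by omega⟩

/-- If the exploration succeeds, the number of faces is the largest possible. -/
theorem IsState.cycleCount_eq (hα : ∀ x, α (α x) = x)
    (h4 : ∀ x, σ (σ (σ (σ x))) = x) (h2 : ∀ x, σ (σ x) ≠ x) {c : List ExplorationStep}
    {ws : List (List D)} (hc : Explores σ α c ws U)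
    (h : IsState σ α s A Cs X U) (hws : live X Cs = ws) :
    2 * cycleCount (s * A) = 2 * cycleCount s + ws.flatten.length := by
  induction hc generalizing s A Cs X with
  | nil =>
    have hCs : Cs = [] := by simpa [live] using hws
    subst hCs
    have : A = 1 := Perm.ext fun x => h.eq_off x fun hx => by simpa using h.cover x hx
    simp [this]
  | pop hc ih =>
    rcases Cs with _ | ⟨C, Cs⟩
    · simp [live] at hws
    simp only [live, List.map_cons, List.cons.injEq] at hws
    simpa using ih (h.pop hws.1) hws.2
  | @join c r w ws U hdU hdw hc ih =>
    obtain ⟨Q, Cs', h, hr, hQ, hws, -⟩ := h.exists_head hws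
    have hcc := h.cycleCount_join (d := α r) (fun hm => h.disj _ hdU (by
      rw [List.flatten_cons]; exact List.mem_append_left _ hm))
    have := ih (h.join hα rfl hr hdU h4 h2) (by rw [h.live_join hdU h4 h2, hws, hQ])
    rw [mul_swap_mul_swap_mul] at this
    rw [this]
    simp
    omega
  | @split c r w w₁ w₂ ws U hw hn hc ih =>
    obtain ⟨Q, Cs', h, hr, hQ, hws, -⟩ := h.exists_head hws
    rw [hw] at hQ
    obtain ⟨W₁, W₂, rfl, h1, h2'⟩ := List.filter_eq_append_iff.mp hQ
    obtain ⟨P, R, rfl, hP, hdX, hR⟩ := List.filter_eq_cons_iff.mp h2'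
    have h' : IsState σ α s A ((r :: ((W₁ ++ P) ++ α r :: R)) :: Cs') X U := by
      simpa [List.append_assoc] using h
    have hP' : P.filter (· ∈ X) = [] := List.filter_eq_nil_iff.mpr hP
    have := ih (h'.split hα rfl hr) (by rw [h'.live_split, hws]; simp [h1, hP', hR])
    rw [mul_swap_mul_swap_mul, h'.cycleCount_split hα rfl hr] at this
    rw [this, hw]
    simp
    omega

end Exploration

/-! ### Maps and words: transport, uniqueness, realization -/

section Words
variable {D : Type*} [DecidableEq D] {σ α : Perm D} {c : List ExplorationStep}
  {ws : List (List D)} {U : Finset D}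

theorem quad_subset (hcl : ∀ x ∈ U, σ x ∈ U) {d : D} (hd : d ∈ U) : quad σ d ⊆ U := by
  intro x hx
  simp only [quad, Finset.mem_insert, Finset.mem_singleton] at hx
  have m1 := hcl d hd
  have m2 := hcl _ m1
  have m3 := hcl _ m2
  rcases hx with rfl | rfl | rfl | rfl <;> assumption

theorem card_quad (h4 : ∀ x, σ (σ (σ (σ x))) = x) (h2 : ∀ x, σ (σ x) ≠ x) (d : D) :
    (quad σ d).card = 4 := by
  have := List.toFinset_card_of_nodup (nodup_quad h4 h2 d)
  simpa [quad] using this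

theorem closed_sdiff_quad (h4 : ∀ x, σ (σ (σ (σ x))) = x) (hcl : ∀ x ∈ U, σ x ∈ U) {d : D}
    (hd : d ∈ U) : ∀ x ∈ U \ quad σ d, σ x ∈ U \ quad σ d := by
  intro x hx
  rw [Finset.mem_sdiff] at hx ⊢
  exact ⟨hcl x hx.1, fun e => hx.2 ((mem_quad_apply (U := U) (fun x _ => h4 x) hd).mp e)⟩

theorem Explores.map {D' : Type*} [DecidableEq D'] {σ' α' : Perm D'} (f : D ↪ D')
    (h4 : ∀ x, σ (σ (σ (σ x))) = x) (h : Explores σ α c ws U)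
    (hσ : ∀ x ∈ U, f (σ x) = σ' (f x)) (hcl : ∀ x ∈ U, σ x ∈ U)
    (hα : ∀ x, x ∈ ws.flatten ∨ x ∈ U → f (α x) = α' (f x)) :
    Explores σ' α' c (ws.map (List.map f)) (U.map f) := by
  induction h with
  | nil => exact .nil
  | pop _ ih => exact (ih hσ hcl (by simpa using hα)).pop
  | @join c r w ws U hdU hdw h ih =>
    have m1 := hcl _ hdU
    have m2 := hcl _ m1
    have m3 := hcl _ m2
    have e : f (α r) = α' (f r) := hα r (by simp)
    have := ih (fun x hx => hσ x (Finset.sdiff_subset hx)) (closed_sdiff_quad h4 hcl hdU) (by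
      intro x hx
      simp only [List.flatten_cons, List.cons_append, List.mem_cons, List.mem_append,
        Finset.mem_sdiff] at hx
      apply hα
      simp only [List.flatten_cons, List.cons_append, List.mem_cons, List.mem_append]
      rcases hx with (rfl | rfl | rfl | h | h) | h
      · exact Or.inr m1
      · exact Or.inr m2
      · exact Or.inr m3
      · exact Or.inl (Or.inr (Or.inl h))
      · exact Or.inl (Or.inr (Or.inr h))
      · exact Or.inr h.1)
    have hq : (quad σ (α r)).map f = quad σ' (α' (f r)) := by
      simp [quad, hσ _ m1, hσ _ m2, hσ _ hdU, e]
    rw [Finset.map_sdiff, hq] at this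
    simp only [List.map_cons, hσ _ m1, hσ _ m2, hσ _ hdU, e] at this
    refine this.join (e ▸ Finset.mem_map_of_mem f hdU) ?_
    rw [← e, List.mem_map_of_injective f.injective]
    exact hdw
  | @split c r w w₁ w₂ ws U hw hn h ih =>
    have e : f (α r) = α' (f r) := hα r (by simp)
    have := ih hσ hcl (by
      intro x hx
      apply hα
      rw [hw]
      simp only [List.flatten_cons, List.cons_append, List.mem_cons, List.mem_append] at hx ⊢
      tauto)
    refine this.split (by simp [hw, e]) ?_
    rw [← e, List.mem_map_of_injective f.injective]
    exact hn

/-- The exploration consults α only on pending and unexplored darts. -/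
theorem Explores.congr {α' : Perm D}
    (h4 : ∀ x, σ (σ (σ (σ x))) = x) (h : Explores σ α c ws U) (hcl : ∀ x ∈ U, σ x ∈ U)
    (hα : ∀ x, x ∈ ws.flatten ∨ x ∈ U → α x = α' x) : Explores σ α' c ws U := by
  have := h.map (σ' := σ) (α' := α') (Function.Embedding.refl D) h4 (fun _ _ => rfl) hcl hα
  rw [show ⇑(Function.Embedding.refl D) = id from rfl] at this
  simpa using this

/-- The darts and the disjointness conditions after following an edge to a new vertex. -/
theorem join_darts {r d : D} {w : List D} (h4 : ∀ x, σ (σ (σ (σ x))) = x)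
    (h2 : ∀ x, σ (σ x) ≠ x) (hn : ((r :: w) :: ws).flatten.Nodup)
    (hdis : ∀ x ∈ U, x ∉ ((r :: w) :: ws).flatten) (hcl : ∀ x ∈ U, σ x ∈ U) (hdU : d ∈ U) :
    ((σ d :: σ (σ d) :: σ (σ (σ d)) :: w) :: ws).flatten.Nodup ∧
    (∀ x ∈ U \ quad σ d, x ∉ ((σ d :: σ (σ d) :: σ (σ (σ d)) :: w) :: ws).flatten) ∧
    ∀ x, (x ∈ ((σ d :: σ (σ d) :: σ (σ (σ d)) :: w) :: ws).flatten ∨ x ∈ U \ quad σ d) ↔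
      (x ∈ ((r :: w) :: ws).flatten ∨ x ∈ U) ∧ x ≠ r ∧ x ≠ d := by
  have m1 := hcl _ hdU
  have m2 := hcl _ m1
  have m3 := hcl _ m2
  have hq := nodup_quad h4 h2 d
  simp only [List.flatten_cons, List.cons_append] at *
  generalize w ++ ws.flatten = F at *
  have d0 := hdis _ hdU
  have d1 := hdis _ m1
  have d2 := hdis _ m2
  have d3 := hdis _ m3
  simp only [List.nodup_cons, List.mem_cons, not_or, List.not_mem_nil, not_false_eq_true,
    and_true, List.nodup_nil] at hq hn d0 d1 d2 d3 ⊢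
  obtain ⟨⟨q1, q2, q3⟩, ⟨q4, q5⟩, q6⟩ := hq
  refine ⟨⟨⟨q4, q5, d1.2⟩, ⟨q6, d2.2⟩, d3.2, hn.2⟩, fun x hx => ?_, fun x => ?_⟩
  · have := hdis x (Finset.sdiff_subset hx)
    simp only [Finset.mem_sdiff, quad, Finset.mem_insert, Finset.mem_singleton, not_or,
      List.mem_cons] at hx this
    exact ⟨hx.2.2.1, hx.2.2.2.1, hx.2.2.2.2, this.2⟩
  · simp only [Finset.mem_sdiff, quad, Finset.mem_insert, Finset.mem_singleton, not_or]
    constructor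
    · rintro ((rfl | rfl | rfl | h) | h)
      · exact ⟨Or.inr m1, d1.1, Ne.symm q1⟩
      · exact ⟨Or.inr m2, d2.1, Ne.symm q2⟩
      · exact ⟨Or.inr m3, d3.1, Ne.symm q3⟩
      · exact ⟨Or.inl (Or.inr h), by rintro rfl; exact hn.1 h, by rintro rfl; exact d0.2 h⟩
      · exact ⟨Or.inr h.1, by rintro rfl; exact hdis _ h.1 (by simp), h.2.1⟩
    · rintro ⟨(h | h) | h, h1, h2⟩
      · exact absurd h h1
      · exact Or.inl (Or.inr (Or.inr (Or.inr h)))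
      · by_cases e1 : x = σ d
        · exact Or.inl (Or.inl e1)
        by_cases e2 : x = σ (σ d)
        · exact Or.inl (Or.inr (Or.inl e2))
        by_cases e3 : x = σ (σ (σ d))
        · exact Or.inl (Or.inr (Or.inr (Or.inl e3)))
        exact Or.inr ⟨h, h2, e1, e2, e3⟩

omit [DecidableEq D] in
/-- The darts and the disjointness conditions after cutting along a loop. -/
theorem split_darts {r d : D} {w₁ w₂ : List D}
    (hn : ((r :: (w₁ ++ d :: w₂)) :: ws).flatten.Nodup)
    (hdis : ∀ x ∈ U, x ∉ ((r :: (w₁ ++ d :: w₂)) :: ws).flatten) :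
    (w₁ :: w₂ :: ws).flatten.Nodup ∧
    (∀ x ∈ U, x ∉ (w₁ :: w₂ :: ws).flatten) ∧ r ≠ d ∧
    ∀ x, (x ∈ (w₁ :: w₂ :: ws).flatten ∨ x ∈ U) ↔
      (x ∈ ((r :: (w₁ ++ d :: w₂)) :: ws).flatten ∨ x ∈ U) ∧ x ≠ r ∧ x ≠ d := by
  have hp : ((r :: (w₁ ++ d :: w₂)) :: ws).flatten.Perm (r :: d :: (w₁ :: w₂ :: ws).flatten) := by
    classical
    rw [List.perm_iff_count]; intro a; simp [List.count_cons]; omega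
  simp only [hp.nodup_iff, hp.mem_iff] at hn hdis ⊢
  generalize (w₁ :: w₂ :: ws).flatten = F at *
  simp only [List.nodup_cons, List.mem_cons, not_or] at hn hdis ⊢
  refine ⟨hn.2.2, fun x hx => (hdis x hx).2.2, hn.1.1, fun x => ⟨?_, ?_⟩⟩
  · rintro (h | h)
    · exact ⟨Or.inl (Or.inr (Or.inr h)), by rintro rfl; exact hn.1.2 h,
        by rintro rfl; exact hn.2.1 h⟩
    · exact ⟨Or.inr h, (hdis x h).1, (hdis x h).2.1⟩
  · rintro ⟨(h | h | h) | h, h1, h2⟩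
    · exact absurd h h1
    · exact absurd h h2
    · exact Or.inl h
    · exact Or.inr h

/-- A join removes exactly one σ-cycle of four darts from U, that is, one vertex. -/
theorem Explores.hasShape (h4 : ∀ x, σ (σ (σ (σ x))) = x) (h2 : ∀ x, σ (σ x) ≠ x)
    (h : Explores σ α c ws U) (hcl : ∀ x ∈ U, σ x ∈ U) {n : ℕ} (hn : U.card = 4 * n) :
    HasShape c (ws.map List.length) n := by
  induction h generalizing n with
  | nil => obtain rfl : n = 0 := by simpa using hn.symm
           exact .nil
  | pop _ ih => exact (ih hcl hn).pop
  | @join c r w ws U hdU hdw h ih =>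
    have hc := Finset.card_sdiff_add_card_eq_card (quad_subset hcl hdU)
    rw [card_quad h4 h2] at hc
    obtain ⟨n, rfl⟩ : ∃ m, n = m + 1 := ⟨n - 1, by omega⟩
    exact (ih (closed_sdiff_quad h4 hcl hdU) (n := n) (by omega)).join
  | @split c r w w₁ w₂ ws U hw hd h ih =>
    have := (ih hcl hn).split
    rw [List.map_cons, show (r :: w).length = w₁.length + w₂.length + 2 by rw [hw]; simp; omega]
    exact this

/-- Every unexplored dart is eventually reached through a join. This gives connectedness of the maps
built from words. -/
theorem Explores.subset_of_closed (h4 : ∀ x, σ (σ (σ (σ x))) = x) (h : Explores σ α c ws U) (hcl : ∀ x ∈ U, σ x ∈ U)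
    {Y : Set D} (hσ : ∀ x ∈ Y, σ x ∈ Y) (hα : ∀ x ∈ Y, α x ∈ Y)
    (hY : ∀ x ∈ ws.flatten, x ∈ Y) : ∀ x ∈ U, x ∈ Y := by
  induction h with
  | nil => simp
  | pop _ ih => exact ih hcl (by simpa using hY)
  | @join c r w ws U hdU hdw h ih =>
    have hd : α r ∈ Y := hα r (hY r (by simp))
    have m1 := hσ _ hd
    have m2 := hσ _ m1
    have m3 := hσ _ m2
    have hq : ∀ x ∈ quad σ (α r), x ∈ Y := by
      intro x hx
      simp only [quad, Finset.mem_insert, Finset.mem_singleton] at hx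
      rcases hx with rfl | rfl | rfl | rfl <;> assumption
    have := ih (closed_sdiff_quad h4 hcl hdU) (by
      intro x hx
      simp only [List.flatten_cons, List.cons_append, List.mem_cons, List.mem_append] at hx hY
      rcases hx with rfl | rfl | rfl | h | h
      · exact m1
      · exact m2
      · exact m3
      · exact hY x (by tauto)
      · exact hY x (by tauto))
    intro x hx
    by_cases hxq : x ∈ quad σ (α r)
    · exact hq x hxq
    · exact this x (Finset.mem_sdiff.mpr ⟨hx, hxq⟩)
  | @split c r w w₁ w₂ ws U hw hd h ih =>
    refine ih hcl fun x hx => hY x ?_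
    rw [hw]
    simp only [List.flatten_cons, List.cons_append, List.mem_cons, List.mem_append] at hx ⊢
    tauto

/-- Two runs with the same word make the same choices in parallel, so matching darts as they are
used defines f. It need not be known injective here. -/
theorem Explores.exists_map {D' : Type*} [DecidableEq D'] [Nonempty D'] {σ' α' : Perm D'}
    {ws' : List (List D')} {U' : Finset D'}
    (hα : ∀ x, α (α x) = x) (hα' : ∀ x, α' (α' x) = x)
    (h4 : ∀ x, σ (σ (σ (σ x))) = x) (h2 : ∀ x, σ (σ x) ≠ x)
    (h4' : ∀ x, σ' (σ' (σ' (σ' x))) = x)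
    (h : Explores σ α c ws U) (h' : Explores σ' α' c ws' U')
    (hn : ws.flatten.Nodup) (hdis : ∀ x ∈ U, x ∉ ws.flatten) (hcl : ∀ x ∈ U, σ x ∈ U) :
    ∃ f : D → D', ws.map (List.map f) = ws' ∧ (∀ x ∈ U, f (σ x) = σ' (f x)) ∧
      ∀ x, x ∈ ws.flatten ∨ x ∈ U → f (α x) = α' (f x) := by
  induction h generalizing ws' U' with
  | nil => cases h'; exact ⟨fun _ => Classical.arbitrary D', by simp⟩
  | pop _ ih =>
    cases h' with
    | pop h' =>
      obtain ⟨f, e1, e2, e3⟩ := ih h' (by simpa using hn) (by simpa using hdis) hcl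
      exact ⟨f, by simp [e1], e2, by simpa using e3⟩
  | @join c r w ws U hdU hdw h ih =>
    cases h' with
    | @join _ r' w' ws' U' hdU' hdw' h' =>
    have d0 := hdis _ hdU
    have hrU : r ∉ U := fun hx => hdis r hx (by simp)
    obtain ⟨j1, j2, j3⟩ := join_darts h4 h2 hn hdis hcl hdU
    obtain ⟨f₀, e1, e2, e3⟩ := ih h' j1 j2 (closed_sdiff_quad h4 hcl hdU)
    simp only [List.map_cons, List.cons.injEq] at e1
    obtain ⟨⟨b1, b2, b3, b4⟩, b5⟩ := e1
    set d := α r with hd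
    have hαd : α d = r := by rw [hd, hα]
    have hrd : r ≠ d := fun e => hrU (e ▸ hdU)
    let f : D → D' := Function.update (Function.update f₀ r r') d (α' r')
    have fd : f d = α' r' := by simp [f]
    have fr : f r = r' := by simp [f, hrd]
    have fx : ∀ x, x ≠ r → x ≠ d → f x = f₀ x := fun x h1 h2 => by simp [f, h1, h2]
    have g : ∀ x ∈ ((σ d :: σ (σ d) :: σ (σ (σ d)) :: w) :: ws).flatten, f x = f₀ x :=
      fun x hx => fx x ((j3 x).mp (Or.inl hx)).2.1 ((j3 x).mp (Or.inl hx)).2.2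
    have g1 := g (σ d) (by simp)
    have g2 := g (σ (σ d)) (by simp)
    have g3 := g (σ (σ (σ d))) (by simp)
    simp only [List.flatten_cons, List.cons_append, List.nodup_cons, List.mem_cons,
      List.mem_append, not_or] at hn d0
    refine ⟨f, ?_, ?_, ?_⟩
    · rw [List.map_cons, List.map_cons, fr, ← b4, ← b5]
      congr 1
      · congr 1
        refine List.map_congr_left fun x hx => fx x ?_ ?_
        · rintro rfl; exact hn.1.1 hx
        · rintro rfl; exact d0.2.1 hx
      · refine List.map_congr_left fun v hv => List.map_congr_left fun x hx => fx x ?_ ?_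
        · rintro rfl; exact hn.1.2 (List.mem_flatten.mpr ⟨v, hv, hx⟩)
        · rintro rfl; exact d0.2.2 (List.mem_flatten.mpr ⟨v, hv, hx⟩)
    · intro x hx
      by_cases hxq : x ∈ quad σ d
      · simp only [quad, Finset.mem_insert, Finset.mem_singleton] at hxq
        rcases hxq with rfl | rfl | rfl | rfl
        · rw [g1, fd, b1]
        · rw [g1, g2, b1, b2]
        · rw [g2, g3, b2, b3]
        · rw [h4, g3, fd, b3, h4']
      · have hx' : x ∈ U \ quad σ d := Finset.mem_sdiff.mpr ⟨hx, hxq⟩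
        have hσx := closed_sdiff_quad h4 hcl hdU x hx'
        have aux : ∀ y ∈ U \ quad σ d, f y = f₀ y := by
          intro y hy
          rw [Finset.mem_sdiff] at hy
          refine fx y (fun e => hrU (e ▸ hy.1)) fun e => hy.2 (by simp [e, quad])
        rw [aux _ hσx, aux _ hx', e2 x hx']
    · intro x hx
      by_cases hxr : x = r
      · subst hxr; rw [← hd, fd, fr]
      by_cases hxd : x = d
      · rw [hxd, hαd, fr, fd, hα']
      rw [fx x hxr hxd, fx (α x) (fun e => hxd (by rw [← hα x, e])) (fun e => hxr (by
        rw [← hα x, e, hαd]))]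
      exact e3 x ((j3 x).mpr ⟨hx, hxr, hxd⟩)
  | @split c r w w₁ w₂ ws U hw hdw h ih =>
    cases h' with
    | @split _ r' w' w₁' w₂' ws' U' hw' hdw' h' =>
    set d := α r with hd
    have hαd : α d = r := by rw [hd, hα]
    subst hw
    obtain ⟨j1, j2, hrd, j3⟩ := split_darts hn hdis
    obtain ⟨f₀, e1, e2, e3⟩ := ih h' j1 j2 hcl
    simp only [List.map_cons, List.cons.injEq] at e1
    obtain ⟨b1, b2, b5⟩ := e1
    let f : D → D' := Function.update (Function.update f₀ r r') d (α' r')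
    have fd : f d = α' r' := by simp [f]
    have fr : f r = r' := by simp [f, hrd]
    have fx : ∀ x, x ≠ r → x ≠ d → f x = f₀ x := fun x h1 h2 => by simp [f, h1, h2]
    have fl : ∀ l ∈ w₁ :: w₂ :: ws, l.map f = l.map f₀ := fun l hl =>
      List.map_congr_left fun x hx =>
        have := (j3 x).mp (Or.inl (List.mem_flatten.mpr ⟨l, hl, hx⟩))
        fx x this.2.1 this.2.2
    have fU : ∀ x ∈ U, f x = f₀ x := fun x hx => fx x
      (by rintro rfl; exact hdis _ hx (by simp)) (by rintro e; exact hdis _ hx (by simp [e]))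
    refine ⟨f, ?_, ?_, ?_⟩
    · rw [List.map_cons, List.map_cons, List.map_append, List.map_cons, fr, fd,
        fl w₁ (by simp), fl w₂ (by simp), b1, b2, hw', ← b5]
      congr 1
      exact List.map_congr_left fun v hv => fl v (by simp [hv])
    · intro x hx
      rw [fU x hx, fU _ (hcl x hx), e2 x hx]
    · intro x hx
      by_cases hxr : x = r
      · subst hxr; rw [← hd, fd, fr]
      by_cases hxd : x = d
      · rw [hxd, hαd, fr, fd, hα']
      rw [fx x hxr hxd, fx (α x) (fun e => hxd (by rw [← hα x, e])) (fun e => hxr (by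
        rw [← hα x, e, hαd]))]
      exact e3 x ((j3 x).mpr ⟨hx, hxr, hxd⟩)

/-- Every word is realized on given darts by a suitable pairing. -/
theorem HasShape.exists_involution (h4 : ∀ x, σ (σ (σ (σ x))) = x) (h2 : ∀ x, σ (σ x) ≠ x)
    {ps : List ℕ} {n : ℕ} (h : HasShape c ps n) (hps : ws.map List.length = ps)
    (hU : U.card = 4 * n)
    (hn : ws.flatten.Nodup) (hdis : ∀ x ∈ U, x ∉ ws.flatten) (hcl : ∀ x ∈ U, σ x ∈ U) :
    ∃ α : Perm D, (∀ x, α (α x) = x) ∧ (∀ x, x ∈ ws.flatten ∨ x ∈ U → α x ≠ x) ∧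
      (∀ x, ¬ (x ∈ ws.flatten ∨ x ∈ U) → α x = x) ∧ Explores σ α c ws U := by
  -- A pairing that fixes r and d is enlarged by the pair {r, d}.
  have aux : ∀ (α₀ : Perm D) (r d : D), r ≠ d → α₀ r = r → α₀ d = d → (∀ x, α₀ (α₀ x) = x) →
      (∀ x, (swap r d * α₀) ((swap r d * α₀) x) = x) ∧ (swap r d * α₀) r = d ∧
      (swap r d * α₀) d = r ∧ ∀ x, x ≠ r → x ≠ d → (swap r d * α₀) x = α₀ x := by
    intro α₀ r d hne hr hd hα
    have h1 : (swap r d * α₀) r = d := by simp [hr]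
    have h2 : (swap r d * α₀) d = r := by simp [hd]
    have h3 : ∀ x, x ≠ r → x ≠ d → (swap r d * α₀) x = α₀ x := by
      intro x h1 h2
      rw [Perm.mul_apply, swap_apply_of_ne_of_ne]
      · intro e; exact h1 (α₀.injective (e.trans hr.symm))
      · intro e; exact h2 (α₀.injective (e.trans hd.symm))
    refine ⟨fun x => ?_, h1, h2, h3⟩
    by_cases hxr : x = r
    · rw [hxr, h1, h2]
    by_cases hxd : x = d
    · rw [hxd, h2, h1]
    rw [h3 x hxr hxd, h3, hα]
    · intro e; exact hxr (α₀.injective (e.trans hr.symm))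
    · intro e; exact hxd (α₀.injective (e.trans hd.symm))
  induction h generalizing ws U with
  | nil =>
    obtain rfl : ws = [] := by simpa using hps
    obtain rfl : U = ∅ := by simpa using hU
    exact ⟨1, by simp, by simp, by simp, .nil⟩
  | pop _ ih =>
    rcases ws with _ | ⟨_ | ⟨r, w⟩, ws⟩
    · simp at hps
    · simp only [List.map_cons, List.cons.injEq] at hps
      obtain ⟨α, a1, a2, a3, a4⟩ := ih hps.2 hU (by simpa using hn) (by simpa using hdis) hcl
      exact ⟨α, a1, by simpa using a2, by simpa using a3, a4.pop⟩
    · simp at hps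
  | @join c p ps n _ ih =>
    rcases ws with _ | ⟨_ | ⟨r, w⟩, ws⟩
    · simp at hps
    · simp at hps
    simp only [List.map_cons, List.cons.injEq, List.length_cons, Nat.add_right_cancel_iff] at hps
    -- Any unexplored dart may serve as the partner, since only σ is prescribed.
    obtain ⟨d, hdU⟩ : U.Nonempty := Finset.card_pos.mp (by omega)
    have d0 := hdis _ hdU
    have hrU : r ∉ U := fun hx => hdis r hx (by simp)
    have hrd : r ≠ d := fun e => hrU (e ▸ hdU)
    have hc := Finset.card_sdiff_add_card_eq_card (quad_subset hcl hdU)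
    rw [card_quad h4 h2] at hc
    obtain ⟨j1, j2, hS⟩ := join_darts h4 h2 hn hdis hcl hdU
    obtain ⟨α₀, a1, a2, a3, a4⟩ := ih (ws := (σ d :: σ (σ d) :: σ (σ (σ d)) :: w) :: ws)
      (U := U \ quad σ d) (by simp [hps]) (by omega) j1 j2 (closed_sdiff_quad h4 hcl hdU)
    obtain ⟨c1, c2, c3, c4⟩ := aux α₀ r d hrd
      (a3 r (by rw [hS]; tauto)) (a3 d (by rw [hS]; tauto)) a1
    refine ⟨swap r d * α₀, c1, ?_, ?_, ?_⟩
    · intro x hx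
      by_cases hxr : x = r
      · rw [hxr, c2]; exact hrd.symm
      by_cases hxd : x = d
      · rw [hxd, c3]; exact hrd
      rw [c4 x hxr hxd]
      exact a2 x ((hS x).mpr ⟨hx, hxr, hxd⟩)
    · intro x hx
      rw [c4 x (by rintro rfl; exact hx (by simp)) (by rintro rfl; exact hx (Or.inr hdU))]
      exact a3 x (by rw [hS]; tauto)
    · have := a4.congr (α' := swap r d * α₀) h4 (closed_sdiff_quad h4 hcl hdU) (fun x hx => by
        have := (hS x).mp hx
        exact (c4 x this.2.1 this.2.2).symm)
      refine Explores.join (c2.symm ▸ hdU) ?_ (c2.symm ▸ this)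
      rw [c2]
      intro hm
      exact d0 (by simp [hm])
  | @split c i j ps n _ ih =>
    rcases ws with _ | ⟨_ | ⟨r, w⟩, ws⟩
    · simp at hps
    · simp at hps
    simp only [List.map_cons, List.cons.injEq, List.length_cons] at hps
    obtain ⟨w₁, d, w₂, rfl, hw₁, hw₂⟩ : ∃ w₁ d w₂, w = w₁ ++ d :: w₂ ∧ w₁.length = i ∧
        w₂.length = j := by
      -- In a split the partner is forced: it is preceded by i darts in the list.
      refine ⟨w.take i, w[i]'(by omega), w.drop (i + 1), ?_, ?_, ?_⟩
      · rw [← List.drop_eq_getElem_cons, List.take_append_drop]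
      · rw [List.length_take]; omega
      · rw [List.length_drop]; omega
    obtain ⟨j1, j2, hrd, hS⟩ := split_darts hn hdis
    obtain ⟨α₀, a1, a2, a3, a4⟩ := ih (ws := w₁ :: w₂ :: ws) (U := U)
      (by simp [hw₁, hw₂, hps.2]) hU j1 j2 hcl
    obtain ⟨c1, c2, c3, c4⟩ := aux α₀ r d hrd
      (a3 r (by rw [hS]; tauto)) (a3 d (by rw [hS]; tauto)) a1
    refine ⟨swap r d * α₀, c1, ?_, ?_, ?_⟩
    · intro x hx
      by_cases hxr : x = r
      · rw [hxr, c2]; exact hrd.symm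
      by_cases hxd : x = d
      · rw [hxd, c3]; exact hrd
      rw [c4 x hxr hxd]
      exact a2 x ((hS x).mpr ⟨hx, hxr, hxd⟩)
    · intro x hx
      rw [c4 x (by rintro rfl; exact hx (by simp)) (by rintro rfl; exact hx (by simp))]
      exact a3 x (by rw [hS]; tauto)
    · have := a4.congr (α' := swap r d * α₀) h4 hcl (fun x hx => by
        have := (hS x).mp hx
        exact (c4 x this.2.1 this.2.2).symm)
      refine Explores.split (by rw [c2]) ?_ this
      rw [c2]
      intro hm
      exact ((hS d).mp (Or.inl (by simp [hm]))).2.2 rfl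

end Words

/-! ### Permutations all of whose cycles have the same length -/

section Regular
variable {D : Type*} [Finite D] {s : Perm D}

theorem card_sameCycle (s : Perm D) (x : D) :
    Nat.card {y // SameCycle s x y} = Function.minimalPeriod s x := by
  classical
  have := Fintype.ofFinite D
  have e : ((s • ·) : D → D) = s := rfl
  rw [← e, MulAction.minimalPeriod_eq_card, ← Nat.card_eq_fintype_card]
  refine Nat.card_congr (Equiv.subtypeEquivRight fun y => ?_)
  rw [MulAction.mem_orbit_iff]
  constructor
  · rintro ⟨i, hi⟩
    exact ⟨⟨s ^ i, Subgroup.zpow_mem_zpowers s i⟩, hi⟩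
  · rintro ⟨⟨g, hg⟩, h⟩
    obtain ⟨i, rfl⟩ := Subgroup.mem_zpowers_iff.mp hg
    exact ⟨i, h⟩

theorem card_eq_mul_cycleCount {k : ℕ} (h : ∀ x, Function.minimalPeriod s x = k) :
    Nat.card D = k * cycleCount s := by
  classical
  have := Fintype.ofFinite (Quotient (SameCycle.setoid s))
  rw [← Nat.card_congr (Equiv.sigmaFiberEquiv (Quotient.mk (SameCycle.setoid s))), Nat.card_sigma,
    Finset.sum_const_nat (m := k), cycleCount, Nat.card_eq_fintype_card, Finset.card_univ, mul_comm]
  intro q _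
  induction q using Quotient.inductionOn with | _ x
  rw [← h x, ← card_sameCycle]
  refine Nat.card_congr (Equiv.subtypeEquivRight fun y => ?_)
  exact Quotient.eq.trans sameCycle_comm

omit [Finite D] in
theorem minimalPeriod_eq_four_iff (x : D) :
    Function.minimalPeriod s x = 4 ↔ s (s (s (s x))) = x ∧ s (s x) ≠ x := by
  constructor
  · intro h
    refine ⟨?_, fun e => ?_⟩
    · have := Function.iterate_minimalPeriod (f := s) (x := x)
      rw [h] at this
      exact this
    · have : Function.minimalPeriod s x ∣ 2 :=
        Function.IsPeriodicPt.minimalPeriod_dvd (show Function.IsPeriodicPt s 2 x from e)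
      rw [h] at this
      omega
  · rintro ⟨h4, h2⟩
    exact Function.minimalPeriod_eq_prime_pow (p := 2) (k := 1) (f := s) (x := x) h2 h4

end Regular

/-! ### Codes of 4-valent rooted maps -/

namespace RootedMap
variable {M N : RootedMap}

instance (M : RootedMap) : Finite M.Dart := M.finite_dart

theorem isFourValent_iff :
    M.IsFourValent ↔ (∀ x, M.σ (M.σ (M.σ (M.σ x))) = x) ∧ ∀ x, M.σ (M.σ x) ≠ x := by
  rw [← forall_and]
  simp_rw [← minimalPeriod_eq_four_iff, ← card_sameCycle]
  have key : ∀ x, M.degree (M.origin x) = Nat.card {y // SameCycle M.σ x y} := fun x =>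
    Nat.card_congr (Equiv.subtypeEquivRight fun y => Quotient.eq.trans sameCycle_comm)
  constructor
  · intro h x
    rw [← key]
    exact h _
  · intro h v
    induction v using Quotient.inductionOn with | _ x
    exact (key x).trans (h x)

theorem IsFourValent.card_dart (h : M.IsFourValent) : Nat.card M.Dart = 4 * Nat.card M.Vertex := by
  rw [isFourValent_iff, ← forall_and] at h
  exact card_eq_mul_cycleCount fun x => (minimalPeriod_eq_four_iff x).mpr (h x)

theorem card_dart_eq_two_mul : Nat.card M.Dart = 2 * Nat.card M.Edge := by
  refine card_eq_mul_cycleCount fun x => ?_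
  exact Function.minimalPeriod_eq_prime (p := 2) (show Function.IsPeriodicPt M.α 2 x from
    M.α_involutive x) (M.α_ne x)

/-- Counting darts by vertices and by edges gives #edges = 2 #vertices, so Euler's relation becomes
#faces = #vertices + 2. The 4 is also the number of live darts in the initial state. -/
theorem IsFourValent.isPlanar_iff (h : M.IsFourValent) :
    M.IsPlanar ↔ 2 * cycleCount (M.σ * M.α) = 2 * cycleCount M.σ + 4 := by
  have h1 := h.card_dart
  have h2 := M.card_dart_eq_two_mul
  have h3 : cycleCount (M.σ * M.α) = Nat.card M.Face := rfl
  have h4 : cycleCount M.σ = Nat.card M.Vertex := rfl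
  rw [h3, h4, IsPlanar]
  omega

/-- On a finite set, being closed under a permutation implies being closed under its inverse, so the
transitive group preserves Y. -/
theorem mem_of_closed {Y : Set M.Dart} (hσ : ∀ x ∈ Y, M.σ x ∈ Y) (hα : ∀ x ∈ Y, M.α x ∈ Y)
    {x : M.Dart} (hx : x ∈ Y) (y : M.Dart) : y ∈ Y := by
  have aux : ∀ s : Perm M.Dart, (∀ x ∈ Y, s x ∈ Y) → ∀ x, x ∈ Y ↔ s x ∈ Y := fun s h x =>
    ⟨h x, fun hs => mem_of_sameCycle h hs (sameCycle_apply_left.mpr (SameCycle.refl _ _))⟩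
  obtain ⟨g, hg, rfl⟩ := M.connected x y
  refine (?_ : ∀ x, x ∈ Y ↔ g x ∈ Y) x |>.mp hx
  induction hg using Subgroup.closure_induction with
  | mem s hs =>
    rcases hs with rfl | rfl
    · exact aux _ hσ
    · exact aux _ hα
  | one => simp
  | mul a b _ _ iha ihb => exact fun x => (ihb x).trans (iha (b x))
  | inv a _ ih =>
    intro x
    have := ih (a⁻¹ x)
    rw [show a (a⁻¹ x) = x by simp] at this
    exact this.symm

/-- The darts around the root vertex of a 4-valent map. -/
def rootDarts (M : RootedMap) : List M.Dart :=
  [M.root, M.σ M.root, M.σ (M.σ M.root), M.σ (M.σ (M.σ M.root))]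

open Classical in
/-- The word `c` describes the exploration of `M`. -/
def HasCode (M : RootedMap) (c : List ExplorationStep) : Prop :=
  ∃ U : Finset M.Dart, (∀ x, x ∈ U ↔ x ∉ M.rootDarts) ∧ Explores M.σ M.α c [M.rootDarts] U

open Classical in
theorem exists_finset_rootDarts (M : RootedMap) :
    ∃ U : Finset M.Dart, ∀ x, x ∈ U ↔ x ∉ M.rootDarts :=
  have := Fintype.ofFinite M.Dart
  ⟨Finset.univ \ M.rootDarts.toFinset, by simp⟩

theorem apply_mem_rootDarts (h4 : ∀ x, M.σ (M.σ (M.σ (M.σ x))) = x) {x : M.Dart} :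
    M.σ x ∈ M.rootDarts ↔ x ∈ M.rootDarts := by
  classical
  have := mem_quad_apply (σ := M.σ) (U := {M.root}) (d := M.root) (fun x _ => h4 x) (by simp)
    (x := x)
  simpa [quad, rootDarts] using this

open Classical in
theorem isState_rootDarts (h4 : ∀ x, M.σ (M.σ (M.σ (M.σ x))) = x) (h2 : ∀ x, M.σ (M.σ x) ≠ x)
    [Fintype M.Dart] {U : Finset M.Dart} (hU : ∀ x, x ∈ U ↔ x ∉ M.rootDarts) :
    IsState M.σ M.α M.σ M.α [M.rootDarts] Finset.univ U where
  nodup := by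
    rw [List.flatten_singleton]
    exact nodup_quad h4 h2 M.root
  cyclic := by simp [IsCyclicList, rootDarts, h4]
  subset := Finset.subset_univ U
  cover x _ := by
    by_cases h : x ∈ M.rootDarts
    · left; simpa using h
    · right; exact (hU x).mpr h
  disj x hx := by simpa using (hU x).mp hx
  apply_eq _ _ := rfl
  closed x hx := by rw [hU, apply_mem_rootDarts h4, ← hU]; exact hx
  closed' _ _ := Finset.mem_univ _
  eq_on _ _ := rfl
  eq_off x hx := absurd (Finset.mem_univ x) hx

open Classical in
theorem IsFourValent.exists_hasCode (h : M.IsFourValent) (hp : M.IsPlanar) :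
    ∃ c, M.HasCode c := by
  have := Fintype.ofFinite M.Dart
  rw [h.isPlanar_iff] at hp
  obtain ⟨h4, h2⟩ := isFourValent_iff.mp h
  obtain ⟨U, hU⟩ := M.exists_finset_rootDarts
  have hs := isState_rootDarts h4 h2 hU
  have hl : live Finset.univ [M.rootDarts] = [M.rootDarts] := by simp [live]
  obtain ⟨c, hc⟩ := (hs.cycleCount_le M.α_involutive M.α_ne h4 h2 (by
    -- A nonempty closed set of darts would contain the root, which is not in U.
    intro Y hY hσ hα
    by_contra hne
    obtain ⟨y, hy⟩ := Finset.nonempty_iff_ne_empty.mpr hne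
    have := mem_of_closed (Y := {x | x ∈ Y}) hσ hα hy M.root
    exact (hU _).mp (hY this) (by simp [rootDarts]))).2 (by rw [hp, hl]; simp [rootDarts])
  rw [hl] at hc
  exact ⟨c, U, hU, hc⟩

open Classical in
theorem HasCode.isPlanar {c : List ExplorationStep} (hc : M.HasCode c) (h : M.IsFourValent) :
    M.IsPlanar := by
  have := Fintype.ofFinite M.Dart
  obtain ⟨h4, h2⟩ := isFourValent_iff.mp h
  obtain ⟨U, hU, hc⟩ := hc
  rw [h.isPlanar_iff, (isState_rootDarts h4 h2 hU).cycleCount_eq M.α_involutive h4 h2 hc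
    (by simp [live])]
  simp [rootDarts]

open Classical in
theorem HasCode.unique {c c' : List ExplorationStep} (hc : M.HasCode c) (hc' : M.HasCode c') :
    c = c' := by
  obtain ⟨U, -, hc⟩ := hc
  obtain ⟨U', -, hc'⟩ := hc'
  exact hc.unique hc'

open Classical in
theorem HasCode.hasShape {c : List ExplorationStep} (hc : M.HasCode c) (h : M.IsFourValent)
    {m : ℕ} (hm : Nat.card M.Vertex = m + 1) : HasShape c [4] m := by
  have := Fintype.ofFinite M.Dart
  have hcard := h.card_dart
  obtain ⟨h4, h2⟩ := isFourValent_iff.mp h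
  obtain ⟨U, hU, hc⟩ := hc
  have hq : Uᶜ = quad M.σ M.root := by
    ext x; rw [Finset.mem_compl, hU, not_not]; simp [rootDarts, quad]
  have hU4 : U.card = 4 * m := by
    have := Finset.card_add_card_compl U
    rw [hq, card_quad h4 h2, ← Nat.card_eq_fintype_card, hcard, hm] at this
    omega
  exact hc.hasShape h4 h2 (isState_rootDarts h4 h2 hU).closed hU4

open Classical in
theorem HasCode.of_iso {c : List ExplorationStep} (hc : M.HasCode c) (h : M.IsFourValent)
    (hMN : M.Iso N) : N.HasCode c := by
  have := Fintype.ofFinite M.Dart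
  obtain ⟨h4, h2⟩ := isFourValent_iff.mp h
  obtain ⟨U, hU, hc⟩ := hc
  obtain ⟨e, hσ, hα, hr⟩ := hMN
  have hl : N.rootDarts = M.rootDarts.map e := by simp [rootDarts, hσ, hr]
  refine ⟨U.map e.toEmbedding, fun x => ?_, ?_⟩
  · rw [hl, Finset.mem_map_equiv, hU, ← List.mem_map_of_injective e.injective,
      Equiv.apply_symm_apply]
  · have := hc.map (σ' := N.σ) (α' := N.α) e.toEmbedding h4 (fun x _ => hσ x)
      (isState_rootDarts h4 h2 hU).closed (fun x _ => hα x)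
    rw [hl]
    exact this

-- The dart map given by the common word commutes with rotation and reversal. Its range is closed
-- and contains the root of N, so it is onto; equal numbers of darts make it bijective.
open Classical in
theorem HasCode.iso {c : List ExplorationStep} (hc : M.HasCode c) (hc' : N.HasCode c)
    (h : M.IsFourValent) (h' : N.IsFourValent)
    (hV : Nat.card M.Vertex = Nat.card N.Vertex) : M.Iso N := by
  have := Fintype.ofFinite M.Dart
  have hcard : Nat.card M.Dart = Nat.card N.Dart := by rw [h.card_dart, h'.card_dart, hV]
  obtain ⟨h4, h2⟩ := isFourValent_iff.mp h
  obtain ⟨h4', h2'⟩ := isFourValent_iff.mp h'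
  obtain ⟨U, hU, hc⟩ := hc
  obtain ⟨U', hU', hc'⟩ := hc'
  have hs := isState_rootDarts h4 h2 hU
  have : Nonempty N.Dart := ⟨N.root⟩
  obtain ⟨f, e1, e2, e3⟩ := hc.exists_map M.α_involutive N.α_involutive h4 h2 h4' hc'
    hs.nodup hs.disj hs.closed
  simp only [rootDarts, List.map_cons, List.map_nil, List.cons.injEq, and_true] at e1
  obtain ⟨r0, r1, r2, r3⟩ := e1
  have hα : ∀ x, f (M.α x) = N.α (f x) := fun x => e3 x (hs.cover x (Finset.mem_univ x))
  have hσ : ∀ x, f (M.σ x) = N.σ (f x) := by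
    intro x
    rcases hs.cover x (Finset.mem_univ x) with hx | hx
    · simp only [List.flatten_cons, List.flatten_nil, List.append_nil, rootDarts, List.mem_cons,
        List.not_mem_nil, or_false] at hx
      rcases hx with rfl | rfl | rfl | rfl
      · rw [r0, r1]
      · rw [r1, r2]
      · rw [r2, r3]
      · rw [h4, r3, r0, h4']
    · exact e2 x hx
  have hsurj : Function.Surjective f := by
    intro y
    refine mem_of_closed (Y := Set.range f) ?_ ?_ ⟨M.root, r0⟩ y
    · rintro _ ⟨x, rfl⟩; exact ⟨_, hσ x⟩
    · rintro _ ⟨x, rfl⟩; exact ⟨_, hα x⟩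
  have hbij : Function.Bijective f := hsurj.bijective_of_nat_card_le hcard.le
  exact ⟨Equiv.ofBijective f hbij, hσ, hα, r0⟩

open Classical in
theorem exists_hasCode_of_perm {D : Type} [Fintype D] (σ : Perm D) (root : D)
    (h4 : ∀ x, σ (σ (σ (σ x))) = x) (h2 : ∀ x, σ (σ x) ≠ x) {m : ℕ}
    (hD : Nat.card D = 4 * (m + 1)) {c : List ExplorationStep} (hc : HasShape c [4] m) :
    ∃ M : RootedMap, M.IsFourValent ∧ Nat.card M.Vertex = m + 1 ∧ M.HasCode c := by
  have hn := nodup_quad h4 h2 root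
  have hl : ∀ x, x ∈ quad σ root ↔ x ∈ [root, σ root, σ (σ root), σ (σ (σ root))] := by
    intro x; simp [quad]
  have hcl : ∀ x ∈ (quad σ root)ᶜ, σ x ∈ (quad σ root)ᶜ := fun x hx => by
    rw [Finset.mem_compl] at hx ⊢
    rwa [mem_quad_apply (U := {root}) (fun x _ => h4 x) (by simp)]
  have hdis : ∀ x ∈ (quad σ root)ᶜ,
      x ∉ [[root, σ root, σ (σ root), σ (σ (σ root))]].flatten := fun x hx => by
    rw [Finset.mem_compl, hl] at hx; simpa using hx
  obtain ⟨α, a1, a2, -, a4⟩ := hc.exists_involution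
    (ws := [[root, σ root, σ (σ root), σ (σ (σ root))]]) (U := (quad σ root)ᶜ) h4 h2 rfl
    (by
      have := Finset.card_add_card_compl (quad σ root)
      rw [card_quad h4 h2, ← Nat.card_eq_fintype_card, hD] at this
      omega) (by simpa using hn) hdis hcl
  have hcov : ∀ x, x ∈ [[root, σ root, σ (σ root), σ (σ (σ root))]].flatten ∨
      x ∈ (quad σ root)ᶜ := fun x => by
    rw [Finset.mem_compl, hl, List.flatten_singleton]; exact Classical.em _
  let G := Subgroup.closure ({σ, α} : Set (Perm D))
  have hσG : σ ∈ G := Subgroup.subset_closure (by simp)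
  have hαG : α ∈ G := Subgroup.subset_closure (by simp)
  let Y : Set D := {x | ∃ g ∈ G, g root = x}
  have hσY : ∀ x ∈ Y, σ x ∈ Y := by
    rintro _ ⟨g, hg, rfl⟩; exact ⟨σ * g, mul_mem hσG hg, rfl⟩
  have hαY : ∀ x ∈ Y, α x ∈ Y := by
    rintro _ ⟨g, hg, rfl⟩; exact ⟨α * g, mul_mem hαG hg, rfl⟩
  have h0 : root ∈ Y := ⟨1, one_mem G, rfl⟩
  have hrY : ∀ x ∈ [[root, σ root, σ (σ root), σ (σ (σ root))]].flatten, x ∈ Y := by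
    intro x hx
    simp only [List.flatten_cons, List.flatten_nil, List.append_nil, List.mem_cons,
      List.not_mem_nil, or_false] at hx
    rcases hx with rfl | rfl | rfl | rfl
    · exact h0
    · exact hσY _ h0
    · exact hσY _ (hσY _ h0)
    · exact hσY _ (hσY _ (hσY _ h0))
  have hY : ∀ x, x ∈ Y := fun x =>
    (hcov x).elim (hrY x) (a4.subset_of_closed h4 hcl hσY hαY hrY x)
  let M : RootedMap :=
    { Dart := D
      finite_dart := inferInstance
      σ := σ
      α := α
      α_involutive := a1
      α_ne := fun x => a2 x (hcov x)
      connected := by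
        intro d d'
        obtain ⟨g, hg, rfl⟩ := hY d
        obtain ⟨g', hg', rfl⟩ := hY d'
        exact ⟨g' * g⁻¹, mul_mem hg' (inv_mem hg), by simp⟩
      root := root }
  have hM : M.IsFourValent := isFourValent_iff.mpr ⟨h4, h2⟩
  refine ⟨M, hM, ?_, (quad σ root)ᶜ, fun x => ?_, a4⟩
  · have h1 : Nat.card D = 4 * Nat.card M.Vertex := hM.card_dart
    omega
  · rw [Finset.mem_compl]
    exact not_congr (hl x)

/-- The vertices are prescribed as m + 1 disjoint copies of the rotation of ℤ/4; the word supplies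
the pairing. -/
theorem exists_hasCode_of_hasShape {m : ℕ} {c : List ExplorationStep} (hc : HasShape c [4] m) :
    ∃ M : RootedMap, M.IsFourValent ∧ Nat.card M.Vertex = m + 1 ∧ M.HasCode c := by
  have h4 : ∀ k : Fin 4, k + 1 + 1 + 1 + 1 = k := by decide
  have h2 : ∀ k : Fin 4, k + 1 + 1 ≠ k := by decide
  refine exists_hasCode_of_perm (D := Fin (m + 1) × Fin 4)
    (Equiv.prodCongr (Equiv.refl _) (Equiv.addRight 1)) (0, 0) ?_ ?_ ?_ hc
  · rintro ⟨i, k⟩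
    exact Prod.ext rfl (h4 k)
  · rintro ⟨i, k⟩ e
    exact h2 k (congrArg Prod.snd e)
  · simp [mul_comm]

end RootedMap

/-! ### The bijection between maps and words, and the conclusion -/

theorem card_fourValentPlanarMap (m : ℕ) :
    Nat.card (FourValentPlanarMap (m + 1)) = Nat.card {c // HasShape c [4] m} := by
  have hex : ∀ M : {M : RootedMap // M.IsPlanar ∧ M.IsFourValent ∧ Nat.card M.Vertex = m + 1},
      ∃ c : {c // HasShape c [4] m}, M.1.HasCode c.1 := fun ⟨M, h1, h2, h3⟩ => by
    obtain ⟨c, hc⟩ := h2.exists_hasCode h1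
    exact ⟨⟨c, hc.hasShape h2 h3⟩, hc⟩
  choose F hF using hex
  let G : FourValentPlanarMap (m + 1) → {c // HasShape c [4] m} :=
    -- Codes are invariant under isomorphism and unique. Injectivity below says that the code
    -- determines the map, and surjectivity uses that a map with a code is planar.
    Quotient.lift F fun M N h =>
      Subtype.ext (((hF M).of_iso M.2.2.1 h).unique (hF N))
  refine Nat.card_congr (Equiv.ofBijective G ⟨?_, ?_⟩)
  · intro a b
    induction a using Quotient.inductionOn with | _ M
    induction b using Quotient.inductionOn with | _ N
    intro (h : F M = F N)
    refine Quotient.sound ?_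
    exact (hF M).iso (h ▸ hF N) M.2.2.1 N.2.2.1 (M.2.2.2.trans N.2.2.2.symm)
  · rintro ⟨c, hc⟩
    obtain ⟨M, h1, h2, h3⟩ := RootedMap.exists_hasCode_of_hasShape hc
    let M' : {M : RootedMap // M.IsPlanar ∧ M.IsFourValent ∧ Nat.card M.Vertex = m + 1} :=
      ⟨M, h3.isPlanar h1, h1, h2⟩
    exact ⟨Quotient.mk _ M', Subtype.ext ((hF M').unique h3)⟩

theorem fourValentCount_eq_coeff (n : ℕ) :
    (fourValentCount n : ℚ) = PowerSeries.coeff n tutteGF := by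
  rcases n with _ | m
  · rw [coeff_zero_tutteGF]; simp [fourValentCount]
  · rw [fourValentCount, if_neg (Nat.succ_ne_zero m), card_fourValentPlanarMap, card_hasShape_four]

theorem fourValentGF_eq : fourValentGF = tutteGF := by
  ext n
  rw [fourValentGF, PowerSeries.coeff_mk, fourValentCount_eq_coeff]

theorem mainTheorem12 :
    (∀ n : ℕ, (fourValentCount n : ℚ) =
      2 * 3 ^ n * (Nat.choose (2 * n) n : ℚ) / (((n : ℚ) + 1) * ((n : ℚ) + 2))) ∧
    blossomingTreeGF = 1 + 3 * PowerSeries.X * blossomingTreeGF ^ 2 ∧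
    fourValentGF = blossomingTreeGF - PowerSeries.X * blossomingTreeGF ^ 3 ∧
    IsAlgebraic (Polynomial ℚ) fourValentGF := by
  rw [blossomingTreeGF_eq, fourValentGF_eq]
  exact ⟨fun n => by rw [fourValentCount_eq_coeff, coeff_tutteGF], ternaryCatalanGF_eq, rfl,
    isAlgebraic_tutteGF⟩
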